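/- **Theorem 3.3 (Linear stability of IMEX-E).** Let $0<\beta<1$, let $\omega^{(\beta)}(z)=\left(\frac12\frac{1+z}{1-z}\right)^\beta=\sum_{j\ge0}\omega^{(\beta)}_jz^j$ (principal branch), and let $m_u,m_f,\widetilde m_f\ge 0$ be integers. Let $0<\sigma_1<\dots<\sigma_{m_u}\le 2-\beta$ and $0<\delta_1<\dots<\delta_{M}\le 2-\beta$ with $M=\max\{m_f,\widetilde m_f\}$. For a step $h>0$, a sequence $\theta$ of exponents and a sequence $G=(G_n)$ put $$I_{h,\theta}^{\beta,n,m}G=h^\beta\sum_{k=0}^n\omega^{(\beta)}_{n-k}G_k+h^\beta\sum_{k=1}^mW^{(\beta,\theta)}_{n,k}G_k+h^\beta B^\theta_nG_0,$$ where the starting weights are determined by $$\sum_{k=1}^{m}W_{n,k}^{(\beta,\theta)}k^{\theta_r}=\frac{\Gamma(\theta_r+1)}{\Gamma(\theta_r+1+\beta)}n^{\theta_r+\beta}-\sum_{k=0}^n\omega^{(\beta)}_{n-k}k^{\theta_r}\quad(1\le r\le m),$$ $$B_n^\theta=\frac{n^\beta}{\Gamma(1+\beta)}-\sum_{k=0}^n\omega^{(\beta)}_{n-k}-\sum_{k=1}^mW^{(\beta,\theta)}_{n,k},$$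 and let $\widehat W_{n,k}$ be determined by $\sum_{k=1}^{\widetilde m_f}\widehat W_{n,k}k^{\delta_r}=n^{\delta_r}-2(n-1)^{\delta_r}+(n-2)^{\delta_r}$ for $1\le r\le\widetilde m_f$. With $n_0=\max\{2,\,1+\max\{m_u,m_f,\widetilde m_f\}\}$, $t_n=nh$ and $F_n=f(t_n,U_n)$, the IMEX-E scheme for ${}^CD_0^\beta u=\lambda u+f(t,u)$ with an additional forcing sequence $(g_n)$ is $$U_n=U_0+\lambda I_{h,\sigma}^{\beta,n,m_u}U+I_{h,\delta}^{\beta,n,m_f}F-h^\beta\omega_0^{(\beta)}F_n+h^\beta\omega^{(\beta)}_0\Big[2F_{n-1}-F_{n-2}+\sum_{k=1}^{\widetilde m_f}\widehat W_{n,k}(F_k-F_0)\Big]+g_n,\qquad n\ge n_0,$$ with given starting values $U_0,\dots,U_{n_0-1}\in\mathbb C$ ($g=0$ is the scheme itself). Apply it to the test equation ${}^CD_0^\beta u=\lambda u+\rho u$, that is $f(t,u)=\rho u$, with $\lambda,\rho\in\mathbb C$. The method is called stable for $(\lambda,\rho,h)$ if for all starting values and every convergent complex sequence $(g_n)$ the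 scheme has exactly one solution $(U_n)$, and $U_n\to0$ as $n\to\infty$. Let $\rho=k\lambda$ with a fixed $k\in\mathbb C$, $k\neq-1$, and define the stability region $\Sigma_\beta^{Num}$ as the set of $\xi\in\mathbb C$ such that the method is stable for all $\lambda\in\mathbb C$ and $h>0$ with $\lambda h^\beta=\xi$. Then $$\Sigma_\beta^{Num}=\mathbb C\setminus\left\{\xi\ \Big|\ \xi=\frac{1}{(k+1)\omega^{(\beta)}(z)-k\,\omega_0^{(\beta)}(1-z)^2},\ |z|\le1\right\}.$$ Here $z=1$ contributes the value $\xi=0$ (since $\omega^{(\beta)}(1)=\infty$), and points $z$ at which the denominator vanishes contribute no value. -/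

import Mathlib

open Filter Topology

noncomputable section

namespace IMEXE

/-- The generating function `ω^{(β)}(z) = (½ (1+z)/(1-z))^β` (principal branch). For `|z| ≤ 1`,
`z ≠ 1`, the base lies in the closed right half-plane. -/
def genFun (β : ℝ) (z : ℂ) : ℂ := ((1 / 2) * ((1 + z) / (1 - z))) ^ (β : ℂ)

/-- The quadrature weights `ω_j^{(β)}`: Taylor coefficients at `0` of the generating function. -/
def omega (β : ℝ) (j : ℕ) : ℂ := iteratedDeriv j (genFun β) 0 / (j.factorial : ℂ)

/-- The matrix `(k^{θ_r})_{1 ≤ r, k ≤ m}` (row `r`, column `k`; `Fin m` is shifted by one). -/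
def powMatrix (θ : ℕ → ℝ) (m : ℕ) : Matrix (Fin m) (Fin m) ℂ :=
  Matrix.of fun r k => ((((k : ℕ) + 1 : ℝ) ^ θ ((r : ℕ) + 1) : ℝ) : ℂ)

/-- The solution `(w_k)_{1 ≤ k ≤ m}` of the linear system
`∑_{k=1}^m w_k k^{θ_r} = b(θ_r)`, `1 ≤ r ≤ m`. The system is uniquely solvable when
`θ_1 < ⋯ < θ_m`, see `powMatrix_det_ne_zero` and `sum_solveWeights`. -/
def solveWeights (θ : ℕ → ℝ) (m : ℕ) (b : ℝ → ℂ) : Fin m → ℂ :=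
  Matrix.mulVec (powMatrix θ m)⁻¹ fun r => b (θ ((r : ℕ) + 1))

/-- The starting weights `W_{n,k}^{(β,θ)}`, which make the corrected quadrature exact for
`t^{θ_r}`, `1 ≤ r ≤ m`. The entry `k : Fin m` belongs to the node `k + 1`. -/
def startWeight (β : ℝ) (θ : ℕ → ℝ) (m n : ℕ) : Fin m → ℂ :=
  solveWeights θ m fun s =>
    ((Real.Gamma (s + 1) / Real.Gamma (s + 1 + β) * (n : ℝ) ^ (s + β) : ℝ) : ℂ)
      - ∑ k ∈ Finset.range (n + 1), omega β (n - k) * (((k : ℝ) ^ s : ℝ) : ℂ)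

/-- The weight `B_n^θ` of the initial value, which makes the quadrature exact for constants. -/
def initWeight (β : ℝ) (θ : ℕ → ℝ) (m n : ℕ) : ℂ :=
  (((n : ℝ) ^ β / Real.Gamma (1 + β) : ℝ) : ℂ)
    - ∑ k ∈ Finset.range (n + 1), omega β (n - k) - ∑ k : Fin m, startWeight β θ m n k

/-- The corrected quadrature `I_{h,θ}^{β,n,m} G`, where `G k` is the value at `t_k = k h`. -/
def quad (β h : ℝ) (θ : ℕ → ℝ) (m n : ℕ) (G : ℕ → ℂ) : ℂ :=
  ((h ^ β : ℝ) : ℂ) * ∑ k ∈ Finset.range (n + 1), omega β (n - k) * G k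
    + ((h ^ β : ℝ) : ℂ) * ∑ k : Fin m, startWeight β θ m n k * G ((k : ℕ) + 1)
    + ((h ^ β : ℝ) : ℂ) * initWeight β θ m n * G 0

/-- The weights of the corrected extrapolation: they make
`G_n = 2 G_{n-1} - G_{n-2} + ∑_{k=1}^m w_k (G_k - G_0)` exact for `t^{θ_r}`, `1 ≤ r ≤ m`. -/
def extrapWeight (θ : ℕ → ℝ) (m n : ℕ) : Fin m → ℂ :=
  solveWeights θ m fun s =>
    (((n : ℝ) ^ s - 2 * ((n : ℝ) - 1) ^ s + ((n : ℝ) - 2) ^ s : ℝ) : ℂ)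

/-- Number of starting values `U_0, …, U_{n₀-1}`: at least the two values used by the
extrapolation, and all the values that occur in the correction terms. -/
def numStart (mu mf mtf : ℕ) : ℕ := max 2 (max mu (max mf mtf) + 1)

/-- `U` satisfies the IMEX-E scheme for `D^β u = λ u + f(t,u)` with step `h`, for all `n ≥ n₀`,
with an additional forcing term `g`; the scheme itself is the case `g = 0`. -/
def IsSolution (β : ℝ) (lam : ℂ) (f : ℝ → ℂ → ℂ) (h : ℝ) (σ δ : ℕ → ℝ) (mu mf mtf : ℕ)
    (g U : ℕ → ℂ) : Prop :=
  let F : ℕ → ℂ := fun j => f (j * h) (U j)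
  ∀ n, numStart mu mf mtf ≤ n →
    U n = U 0 + lam * quad β h σ mu n U + quad β h δ mf n F
        - ((h ^ β : ℝ) : ℂ) * omega β 0 * F n
        + ((h ^ β : ℝ) : ℂ) * omega β 0 * (2 * F (n - 1) - F (n - 2)
          + ∑ k : Fin mtf, extrapWeight δ mtf n k * (F ((k : ℕ) + 1) - F 0))
        + g n

/-- Stability of IMEX-E with step `h` for the test equation `D^β u = λ u + ρ u` (the term `ρ u`
is treated explicitly). As usual for convolution quadratures `y_n = g_n + ξ ∑ w_{n-j} y_j`, it
means that for all starting values and every convergent sequence `g`, the scheme determines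
a unique numerical solution and this solution tends to `0`. -/
def IsStable (β : ℝ) (lam ρ : ℂ) (h : ℝ) (σ δ : ℕ → ℝ) (mu mf mtf : ℕ) : Prop :=
  ∀ a g : ℕ → ℂ, (∃ L : ℂ, Tendsto g atTop (𝓝 L)) →
    (∃! U : ℕ → ℂ, (∀ n < numStart mu mf mtf, U n = a n) ∧
      IsSolution β lam (fun _ u => ρ * u) h σ δ mu mf mtf g U) ∧
    ∀ U : ℕ → ℂ, (∀ n < numStart mu mf mtf, U n = a n) →
      IsSolution β lam (fun _ u => ρ * u) h σ δ mu mf mtf g U → Tendsto U atTop (𝓝 0)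

/-- The stability region for `ρ = k λ`: the set of `ξ = λ h^β` for which the method is stable. -/
def stabilityRegion (β : ℝ) (k : ℂ) (σ δ : ℕ → ℝ) (mu mf mtf : ℕ) : Set ℂ :=
  {ξ | ∀ (lam : ℂ) (h : ℝ), 0 < h → ξ = lam * ((h ^ β : ℝ) : ℂ) →
    IsStable β lam (k * lam) h σ δ mu mf mtf}

/-- A generalized polynomial with `m` terms and `m` positive zeros vanishes. -/
theorem coeff_eq_zero_of_zeros (m : ℕ) : ∀ (θ c x : Fin m → ℝ), StrictMono θ → StrictMono x →
    (∀ i, 0 < x i) → (∀ i, ∑ r, c r * x i ^ θ r = 0) → c = 0 := by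
  induction m with
  | zero => intro θ c x _ _ _ _; exact Subsingleton.elim _ _
  | succ m ih =>
    intro θ c x hθ hx h0 hz
    have hg : ∀ i, ∑ r, c r * x i ^ (θ r - θ 0) = 0 := by
      intro i
      have h1 : ∑ r, c r * x i ^ (θ r - θ 0) = (∑ r, c r * x i ^ θ r) / x i ^ θ 0 := by
        rw [Finset.sum_div]
        refine Finset.sum_congr rfl fun r _ => ?_
        rw [Real.rpow_sub (h0 i), mul_div_assoc]
      rw [h1, hz i, zero_div]
    have hder : ∀ y : ℝ, 0 < y → HasDerivAt (fun y => ∑ r, c r * y ^ (θ r - θ 0))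
        (∑ r, c r * ((θ r - θ 0) * y ^ (θ r - θ 0 - 1))) y := by
      intro y hy
      refine HasDerivAt.fun_sum fun r _ => ?_
      exact (Real.hasDerivAt_rpow_const (Or.inl hy.ne')).const_mul _
    have hroll : ∀ i : Fin m, ∃ y ∈ Set.Ioo (x i.castSucc) (x i.succ),
        ∑ r, c r * ((θ r - θ 0) * y ^ (θ r - θ 0 - 1)) = 0 := by
      intro i
      have hlt : x i.castSucc < x i.succ := hx i.castSucc_lt_succ
      refine exists_hasDerivAt_eq_zero (f := fun y => ∑ r, c r * y ^ (θ r - θ 0)) hlt ?_ ?_ ?_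
      · intro y hy
        exact (hder y ((h0 _).trans_le hy.1)).continuousAt.continuousWithinAt
      · simp only [hg]
      · intro y hy
        exact hder y ((h0 _).trans hy.1)
    choose y hy hy0 using hroll
    have hc : (fun r : Fin m => c r.succ * (θ r.succ - θ 0)) = 0 := by
      refine ih (fun r => θ r.succ - θ 0 - 1) _ y ?_ ?_ ?_ ?_
      · intro a b hab
        have : θ a.succ < θ b.succ := hθ (Fin.succ_lt_succ_iff.2 hab)
        simpa using this
      · intro a b hab
        have h2 : x a.succ ≤ x b.castSucc := hx.monotone (by
          rw [Fin.le_def]; simpa using hab)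
        exact (hy a).2.trans_le (h2.trans (hy b).1.le)
      · intro i; exact (h0 _).trans (hy i).1
      · intro i
        have := hy0 i
        rw [Fin.sum_univ_succ] at this
        simpa [mul_assoc] using this
    have hs : ∀ r : Fin m, c r.succ = 0 := by
      intro r
      have h3 := congrFun hc r
      have h4 : θ 0 < θ r.succ := hθ (Fin.succ_pos r)
      simpa [(sub_pos.2 h4).ne'] using h3
    have h5 : c 0 = 0 := by
      have := hg 0
      rw [Fin.sum_univ_succ] at this
      simpa [hs] using this
    funext r
    refine Fin.cases h5 hs r

theorem powMatrix_det_ne_zero (θ : ℕ → ℝ) (m : ℕ) (hθ : StrictMonoOn θ (Set.Icc 1 m)) :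
    (powMatrix θ m).det ≠ 0 := by
  set V : Matrix (Fin m) (Fin m) ℝ :=
    Matrix.of fun r k => ((k : ℕ) + 1 : ℝ) ^ θ ((r : ℕ) + 1) with hV
  have h1 : powMatrix θ m = V.map (Complex.ofRealHom : ℝ →+* ℂ) := by
    ext r k; simp [powMatrix, hV]
  have h2 : V.det ≠ 0 := by
    intro h
    obtain ⟨v, hv, hv0⟩ := Matrix.exists_vecMul_eq_zero_iff.2 h
    refine hv (coeff_eq_zero_of_zeros m (fun r => θ ((r : ℕ) + 1)) v
      (fun k => ((k : ℕ) + 1 : ℝ)) ?_ ?_ ?_ ?_)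
    · intro a b hab
      refine hθ ⟨by omega, by have := a.2; omega⟩ ⟨by omega, by have := b.2; omega⟩ ?_
      have : (a : ℕ) < b := hab
      omega
    · intro a b hab
      have : (a : ℕ) < b := hab
      simpa using this
    · intro i; positivity
    · intro i
      have := congrFun hv0 i
      simpa [Matrix.vecMul, dotProduct, hV] using this
  rw [h1]
  have h3 := RingHom.map_det (Complex.ofRealHom : ℝ →+* ℂ) V
  rw [RingHom.mapMatrix_apply] at h3
  rw [← h3]
  simpa using h2

/-- The weights do solve their linear system. -/
theorem sum_solveWeights (θ : ℕ → ℝ) (m : ℕ) (hθ : StrictMonoOn θ (Set.Icc 1 m)) (b : ℝ → ℂ)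
    (r : ℕ) (hr : r ∈ Set.Icc 1 m) :
    ∑ k : Fin m, solveWeights θ m b k * ((((k : ℕ) + 1 : ℝ) ^ θ r : ℝ) : ℂ) = b (θ r) := by
  have h1 : Matrix.mulVec (powMatrix θ m) (solveWeights θ m b)
      = fun r : Fin m => b (θ ((r : ℕ) + 1)) := by
    rw [solveWeights, Matrix.mulVec_mulVec,
      Matrix.mul_nonsing_inv _ (isUnit_iff_ne_zero.2 (powMatrix_det_ne_zero θ m hθ)),
      Matrix.one_mulVec]
  obtain ⟨hr1, hr2⟩ := hr
  have h2 := congrFun h1 ⟨r - 1, by omega⟩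
  have h3 : r - 1 + 1 = r := by omega
  simp only [Matrix.mulVec, dotProduct, powMatrix, Matrix.of_apply, h3] at h2
  rw [← h2]
  exact Finset.sum_congr rfl fun k _ => mul_comm _ _

end IMEXE

end

/-!
# Linear stability of the IMEX-E scheme

Write `ξ = λ h^β` and `w(z) = (k + 1) ω(z) - k ω_0 (1 - z)^2`. For the test equation the scheme is
the convolution equation `(1 - ξ w) U = G` between power series, where `G` consists of the forcing
`g` and of the contribution of the starting values (`isSolution_iff`).

The starting weights converge as `n → ∞`, so that `G` converges whenever `g` does. Indeed `n^s` is
expanded in the coefficients of `(1 - z)^{-s-1}`, `(1 - z)^{-s}`, `(1 - z)^{1-s}` with an absolutely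
summable remainder (`powSeries_eq`), and `((1 + z) / 2)^β` in powers of `1 - z` (`halfPow_eq`). In
the quadrature error for `t^θ` the two leading terms cancel, and what remains is
`(1 - z)^{1-θ-β}`, with convergent coefficients since `θ + β ≤ 2` (`conv_quadrature_error`).

Multiplication by `(1 - z)^β` turns `1 - ξ w`, singular at `z = 1`, into a series `D` with
absolutely summable coefficients (`symbolSeries`), with `D(z) = (1 - z)^β (1 - ξ w(z))` for `z ≠ 1` and
`D(1) = -ξ (k + 1)`.

* If `ξ` is not in the excluded set, `D` has no zero in the closed disc, so by Wiener's lemma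
  (`AbsSum.exists_mul_eq_one`) the resolvent `r = (1 - z)^β / D` is absolutely summable, with
  `r(1) = 0`. Hence `U = r G` exists, is unique, and tends to `0`
  (`isStable_of_symbolSeries_ne_zero`).
* If `D(z₀) = 0` with `z₀ ≠ 0, 1`, then `U = (1 - z)^β / (1 - z / z₀)` does not tend to `0`, while
  `(1 - ξ w) U = D / (1 - z / z₀)` does. For `z₀ = 0` step `n₀` is not solvable, and for `ξ = 0` the
  scheme just adds `g_n` to the initial value.
-/

noncomputable section

namespace IMEXE

open PowerSeries Finset

/-! ### Power series with absolutely summable coefficients -/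

/-- The coefficients of `f` are absolutely summable: `f` lies in the Wiener algebra `ℓ¹`. -/
def AbsSum (f : ℂ⟦X⟧) : Prop := Summable fun n => ‖coeff n f‖

/-- The value of `f` at `z`, as an unconditional sum; meaningful for `‖z‖ ≤ 1` when `AbsSum f`. -/
def ev (f : ℂ⟦X⟧) (z : ℂ) : ℂ := ∑' n, coeff n f * z ^ n

/-- The truncated `ℓ¹` norms `∑_{n<K} ‖f_n‖` are submultiplicative. Unlike the full norm they are
finite for every power series, which makes absorption arguments possible. -/
theorem sum_norm_coeff_mul_le (f g : ℂ⟦X⟧) (K : ℕ) :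
    ∑ n ∈ range K, ‖coeff n (f * g)‖ ≤
      (∑ n ∈ range K, ‖coeff n f‖) * ∑ n ∈ range K, ‖coeff n g‖ := by
  rw [sum_mul_sum, ← sum_product']
  refine le_trans ?_ (sum_fiberwise_le_sum_of_sum_fiber_nonneg (t := range K)
    (g := fun p : ℕ × ℕ => p.1 + p.2) fun n _ => sum_nonneg fun p _ => by positivity)
  refine sum_le_sum fun n hn => ?_
  rw [coeff_mul]
  refine (norm_sum_le _ _).trans (le_of_eq ?_)
  have h : antidiagonal n = {p ∈ range K ×ˢ range K | p.1 + p.2 = n} := by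
    ext p
    simp only [HasAntidiagonal.mem_antidiagonal, mem_filter, mem_product, mem_range] at hn ⊢
    omega
  rw [h]
  exact sum_congr rfl fun p _ => norm_mul _ _

theorem absSum_of_bound {f : ℂ⟦X⟧} {c : ℝ} (h : ∀ K, ∑ n ∈ range K, ‖coeff n f‖ ≤ c) :
    AbsSum f :=
  summable_of_sum_range_le (fun _ => norm_nonneg _) h

theorem AbsSum.sum_le {f : ℂ⟦X⟧} (hf : AbsSum f) (K : ℕ) :
    ∑ n ∈ range K, ‖coeff n f‖ ≤ ∑' n, ‖coeff n f‖ :=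
  hf.sum_le_tsum _ fun _ _ => norm_nonneg _

theorem AbsSum.mul {f g : ℂ⟦X⟧} (hf : AbsSum f) (hg : AbsSum g) : AbsSum (f * g) :=
  absSum_of_bound fun K => (sum_norm_coeff_mul_le f g K).trans
    (mul_le_mul (hf.sum_le K) (hg.sum_le K) (by positivity) (by positivity))

theorem AbsSum.add {f g : ℂ⟦X⟧} (hf : AbsSum f) (hg : AbsSum g) : AbsSum (f + g) :=
  Summable.of_nonneg_of_le (fun _ => norm_nonneg _)
    (fun n => by simpa using norm_add_le _ _) (Summable.add hf hg)

theorem AbsSum.neg {f : ℂ⟦X⟧} (hf : AbsSum f) : AbsSum (-f) := by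
  simpa [AbsSum] using hf

theorem AbsSum.sub {f g : ℂ⟦X⟧} (hf : AbsSum f) (hg : AbsSum g) : AbsSum (f - g) := by
  rw [sub_eq_add_neg]; exact hf.add hg.neg

theorem absSum_coe (p : Polynomial ℂ) : AbsSum (p : ℂ⟦X⟧) := by
  refine summable_of_ne_finset_zero (s := p.support) fun n hn => ?_
  simpa using hn

theorem absSum_C (c : ℂ) : AbsSum (C c) := by
  simpa using absSum_coe (Polynomial.C c)

theorem absSum_X : AbsSum X := by
  simpa using absSum_coe Polynomial.X

theorem absSum_one : AbsSum 1 := by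
  simpa using absSum_C 1

theorem AbsSum.pow {f : ℂ⟦X⟧} (hf : AbsSum f) (m : ℕ) : AbsSum (f ^ m) := by
  induction m with
  | zero => simpa using absSum_one
  | succ m ih => rw [pow_succ]; exact ih.mul hf

theorem AbsSum.summable_norm_eval {f : ℂ⟦X⟧} (hf : AbsSum f) {z : ℂ} (hz : ‖z‖ ≤ 1) :
    Summable fun n => ‖coeff n f * z ^ n‖ := by
  refine Summable.of_nonneg_of_le (fun _ => norm_nonneg _) (fun n => ?_) hf
  rw [norm_mul, norm_pow]
  exact mul_le_of_le_one_right (norm_nonneg _) (pow_le_one₀ (norm_nonneg _) hz)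

theorem AbsSum.hasSum_ev {f : ℂ⟦X⟧} (hf : AbsSum f) {z : ℂ} (hz : ‖z‖ ≤ 1) :
    HasSum (fun n => coeff n f * z ^ n) (ev f z) :=
  (hf.summable_norm_eval hz).of_norm.hasSum

/-- Cauchy product, for absolutely convergent series at a point. -/
theorem hasSum_coeff_mul {f g : ℂ⟦X⟧} {z : ℂ} (hf : Summable fun n => ‖coeff n f * z ^ n‖)
    (hg : Summable fun n => ‖coeff n g * z ^ n‖) :
    HasSum (fun n => coeff n (f * g) * z ^ n) (ev f z * ev g z) := by
  have h : (fun n => coeff n (f * g) * z ^ n)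
      = fun n => ∑ p ∈ antidiagonal n, coeff p.1 f * z ^ p.1 * (coeff p.2 g * z ^ p.2) := by
    funext n
    rw [coeff_mul, sum_mul]
    refine sum_congr rfl fun p hp => ?_
    rw [← HasAntidiagonal.mem_antidiagonal.1 hp, pow_add]
    ring
  rw [h, ev, ev, tsum_mul_tsum_eq_tsum_sum_antidiagonal_of_summable_norm hf hg]
  exact (summable_norm_sum_mul_antidiagonal_of_summable_norm hf hg).of_norm.hasSum

theorem AbsSum.ev_mul {f g : ℂ⟦X⟧} (hf : AbsSum f) (hg : AbsSum g) {z : ℂ} (hz : ‖z‖ ≤ 1) :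
    ev (f * g) z = ev f z * ev g z :=
  (hasSum_coeff_mul (hf.summable_norm_eval hz) (hg.summable_norm_eval hz)).tsum_eq

theorem AbsSum.ev_add {f g : ℂ⟦X⟧} (hf : AbsSum f) (hg : AbsSum g) {z : ℂ} (hz : ‖z‖ ≤ 1) :
    ev (f + g) z = ev f z + ev g z := by
  refine HasSum.tsum_eq ?_
  simpa [add_mul] using (hf.hasSum_ev hz).add (hg.hasSum_ev hz)

theorem AbsSum.ev_sub {f g : ℂ⟦X⟧} (hf : AbsSum f) (hg : AbsSum g) {z : ℂ} (hz : ‖z‖ ≤ 1) :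
    ev (f - g) z = ev f z - ev g z := by
  refine HasSum.tsum_eq ?_
  simpa [sub_mul] using (hf.hasSum_ev hz).sub (hg.hasSum_ev hz)

theorem ev_coe (p : Polynomial ℂ) (z : ℂ) : ev (p : ℂ⟦X⟧) z = p.eval z := by
  rw [ev, tsum_eq_sum (s := p.support), Polynomial.eval_eq_sum, Polynomial.sum]
  · simp
  · intro n hn
    simp [Polynomial.notMem_support_iff.1 hn]

theorem ev_C (c z : ℂ) : ev (C c) z = c := by
  simpa using ev_coe (Polynomial.C c) z

theorem ev_X (z : ℂ) : ev X z = z := by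
  simpa using ev_coe Polynomial.X z

theorem ev_one (z : ℂ) : ev 1 z = 1 := by
  simpa using ev_C 1 z

theorem AbsSum.ev_pow {f : ℂ⟦X⟧} (hf : AbsSum f) {z : ℂ} (hz : ‖z‖ ≤ 1) (m : ℕ) :
    ev (f ^ m) z = ev f z ^ m := by
  induction m with
  | zero => simpa using ev_one z
  | succ m ih => rw [pow_succ, (hf.pow m).ev_mul hf hz, ih, pow_succ]

theorem AbsSum.continuousOn_ev {f : ℂ⟦X⟧} (hf : AbsSum f) :
    ContinuousOn (ev f) (Metric.closedBall 0 1) := by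
  refine continuousOn_tsum (u := fun n => ‖coeff n f‖) (fun n => by fun_prop) hf ?_
  intro n z hz
  rw [norm_mul, norm_pow]
  exact mul_le_of_le_one_right (norm_nonneg _)
    (pow_le_one₀ (norm_nonneg _) (by simpa using hz))

/-- Coefficients of a power series that converges on the unit disc are the Taylor coefficients of
its sum; in particular a power series is determined by its values there. -/
theorem coeff_eq_iteratedDeriv {f : ℂ⟦X⟧} {F : ℂ → ℂ}
    (h : ∀ z : ℂ, ‖z‖ < 1 → HasSum (fun n => coeff n f * z ^ n) (F z)) (n : ℕ) :
    coeff n f = iteratedDeriv n F 0 / (n.factorial : ℂ) := by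
  have hp : HasFPowerSeriesOnBall F
      (FormalMultilinearSeries.ofScalars ℂ fun n => coeff n f) 0 1 := by
    refine ⟨?_, one_pos, ?_⟩
    · refine ENNReal.le_of_forall_nnreal_lt fun r hr => ?_
      refine FormalMultilinearSeries.le_radius_of_summable_norm _ ?_
      have hr1 : (r : ℝ) < 1 := by exact_mod_cast hr
      have h1 := (h (r : ℝ) (by simpa using hr1)).summable.norm
      refine h1.congr fun n => ?_
      simp
    · intro z hz
      have hz' : ‖z‖ < 1 := by
        rw [← ENNReal.ofReal_one, Metric.eball_ofReal] at hz
        simpa using hz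
      simpa [FormalMultilinearSeries.ofScalars_apply_eq, mul_comm] using h z hz'
  have h1 := hp.hasFPowerSeriesAt.eq_formalMultilinearSeries
    (AnalyticAt.hasFPowerSeriesAt hp.analyticAt)
  have h2 := congrFun ((FormalMultilinearSeries.ofScalars_series_eq_iff ℂ _ _).1 h1) n
  exact h2

theorem AbsSum.ext_ev {f g : ℂ⟦X⟧} (hf : AbsSum f) (hg : AbsSum g)
    (h : ∀ z : ℂ, ‖z‖ < 1 → ev f z = ev g z) : f = g := by
  ext n
  rw [coeff_eq_iteratedDeriv (F := ev g) (fun z hz => ?_) n,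
    coeff_eq_iteratedDeriv (F := ev g) (fun z hz => hg.hasSum_ev hz.le) n]
  rw [← h z hz]
  exact hf.hasSum_ev hz.le

/-- Convolution of an `ℓ¹` sequence with a sequence tending to `L` tends to `f(1) L`, by dominated
convergence. In particular the limit is `0` when `f(1) = 0`. -/
theorem AbsSum.tendsto_coeff_mul {f g : ℂ⟦X⟧} (hf : AbsSum f) {L : ℂ}
    (hg : Tendsto (fun n => coeff n g) atTop (𝓝 L)) :
    Tendsto (fun n => coeff n (f * g)) atTop (𝓝 (ev f 1 * L)) := by
  obtain ⟨c, hc⟩ := hg.norm.bddAbove_range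
  have hc' : ∀ n, ‖coeff n g‖ ≤ c := fun n => hc ⟨n, rfl⟩
  have h1 : ∀ n, coeff n (f * g) = ∑' j, if j ≤ n then coeff j f * coeff (n - j) g else 0 := by
    intro n
    rw [coeff_mul, Nat.sum_antidiagonal_eq_sum_range_succ_mk, tsum_eq_sum (s := range (n + 1))]
    · refine sum_congr rfl fun j hj => ?_
      rw [if_pos (Nat.lt_succ_iff.1 (mem_range.1 hj))]
    · intro j hj
      rw [if_neg]
      simpa using hj
  have h2 : ev f 1 * L = ∑' j, coeff j f * L := by simp [ev, tsum_mul_right]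
  simp only [h1, h2]
  refine tendsto_tsum_of_dominated_convergence (bound := fun j => ‖coeff j f‖ * c)
    (Summable.mul_right c hf) ?_ ?_
  · intro j
    refine ((hg.comp (tendsto_sub_atTop_nat j)).const_mul (coeff j f)).congr' ?_
    filter_upwards [eventually_ge_atTop j] with n hn
    simp [hn]
  · refine Eventually.of_forall fun n j => ?_
    split_ifs
    · rw [norm_mul]
      exact mul_le_mul_of_nonneg_left (hc' _) (norm_nonneg _)
    · rw [norm_zero]
      exact mul_nonneg (norm_nonneg _) ((norm_nonneg _).trans (hc' 0))

theorem AbsSum.tendsto_coeff {f : ℂ⟦X⟧} (hf : AbsSum f) :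
    Tendsto (fun n => coeff n f) atTop (𝓝 0) :=
  tendsto_zero_iff_norm_tendsto_zero.2 hf.tendsto_atTop_zero

/-! ### Wiener's lemma -/

/-- A function holomorphic on a disc of radius `R > 1` is the sum of a series with geometrically
decaying coefficients (Cauchy's estimates). -/
theorem exists_series_of_differentiableOn {F : ℂ → ℂ} {R M : ℝ} (hR : 1 < R)
    (hF : DifferentiableOn ℂ F (Metric.closedBall 0 R))
    (hM : ∀ z ∈ Metric.closedBall (0 : ℂ) R, ‖F z‖ ≤ M) :
    ∃ f : ℂ⟦X⟧, (∀ n, ‖coeff n f‖ ≤ M * R⁻¹ ^ n) ∧ ∀ z : ℂ, ‖z‖ ≤ 1 → ev f z = F z := by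
  have hR0 : 0 < R := one_pos.trans hR
  lift R to NNReal using hR0.le
  have hR0' : 0 < R := by exact_mod_cast hR0
  have hp := hF.hasFPowerSeriesOnBall hR0'
  refine ⟨PowerSeries.mk fun n => iteratedDeriv n F 0 / (n.factorial : ℂ), fun n => ?_,
    fun z hz => ?_⟩
  · rw [coeff_mk, norm_div, Complex.norm_natCast, div_le_iff₀ (by positivity)]
    have h := Complex.norm_iteratedDeriv_le_of_forall_mem_sphere_norm_le n hR0
      (f := F) (c := 0) (C := M) (hF.diffContOnCl_ball subset_rfl)
      (fun z hz => hM z (Metric.sphere_subset_closedBall hz))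
    refine h.trans (le_of_eq ?_)
    rw [inv_pow]
    field_simp
  · have hz' : z ∈ Metric.ball (0 : ℂ) R := by simpa using hz.trans_lt hR
    have h := Complex.hasSum_taylorSeries_on_ball (f := F) (c := 0)
      (hF.mono Metric.ball_subset_closedBall) hz'
    rw [ev, ← h.tsum_eq]
    refine tsum_congr fun n => ?_
    simp
    ring

/-- For a polynomial without zeros in the closed unit disc, the `m`-th power of the reciprocal has
`ℓ¹` norm at most `c ε⁻ᵐ` with `c` independent of `m`: by compactness `|p| > ε` on a disc of radius
`R > 1`, and Cauchy's estimates give `c = ∑ R⁻ⁿ`. -/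
theorem exists_inverse_polynomial {p : Polynomial ℂ} {ε : ℝ} (hε : 0 < ε)
    (hp : ∀ z : ℂ, ‖z‖ ≤ 1 → ε < ‖p.eval z‖) :
    ∃ (q : ℂ⟦X⟧) (c : ℝ), (p : ℂ⟦X⟧) * q = 1 ∧ 0 ≤ c ∧
      ∀ m K : ℕ, ∑ n ∈ range K, ‖coeff n (q ^ m)‖ ≤ c * ε⁻¹ ^ m := by
  obtain ⟨η, hη, hsub⟩ := (isCompact_closedBall (0 : ℂ) 1).exists_cthickening_subset_open
    (t := {z | ε < ‖p.eval z‖}) (isOpen_lt continuous_const p.continuous.norm)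
    (fun z hz => hp z (by simpa using hz))
  rw [cthickening_closedBall hη.le zero_le_one] at hsub
  have hR : 1 < η + 1 := by linarith
  have h0 : ∀ z ∈ Metric.closedBall (0 : ℂ) (η + 1), p.eval z ≠ 0 := by
    intro z hz h
    have := hsub hz
    simp only [Set.mem_ofPred_eq, h, norm_zero] at this
    linarith
  have key : ∀ m : ℕ, ∃ f : ℂ⟦X⟧, (∀ n, ‖coeff n f‖ ≤ ε⁻¹ ^ m * (η + 1)⁻¹ ^ n) ∧
      ∀ z : ℂ, ‖z‖ ≤ 1 → ev f z = ((p.eval z)⁻¹) ^ m := by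
    intro m
    refine exists_series_of_differentiableOn hR ?_ ?_
    · exact (p.differentiable.differentiableOn.inv h0).pow m
    · intro z hz
      rw [norm_pow, norm_inv]
      have : ε < ‖p.eval z‖ := hsub hz
      gcongr
  have hr0 : 0 ≤ (η + 1)⁻¹ := by positivity
  have hr1 : (η + 1)⁻¹ < 1 := inv_lt_one_of_one_lt₀ hR
  have hgeo := summable_geometric_of_lt_one hr0 hr1
  choose f hf hfev using key
  have habs : ∀ m, AbsSum (f m) := fun m =>
    Summable.of_nonneg_of_le (fun _ => norm_nonneg _) (hf m) (hgeo.mul_left _)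
  have hpow : ∀ m, (f 1) ^ m = f m := by
    intro m
    refine ((habs 1).pow m).ext_ev (habs m) fun z hz => ?_
    rw [(habs 1).ev_pow hz.le, hfev 1 z hz.le, hfev m z hz.le, pow_one]
  refine ⟨f 1, ∑' n, (η + 1)⁻¹ ^ n, ?_, by positivity, fun m K => ?_⟩
  · refine ((absSum_coe p).mul (habs 1)).ext_ev absSum_one fun z hz => ?_
    rw [(absSum_coe p).ev_mul (habs 1) hz.le, ev_coe, hfev 1 z hz.le, pow_one, ev_one,
      mul_inv_cancel₀ (h0 z (by simpa using (hz.trans hR).le))]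
  · rw [hpow m]
    calc ∑ n ∈ range K, ‖coeff n (f m)‖ ≤ ∑ n ∈ range K, ε⁻¹ ^ m * (η + 1)⁻¹ ^ n :=
          sum_le_sum fun n _ => hf m n
      _ = ε⁻¹ ^ m * ∑ n ∈ range K, (η + 1)⁻¹ ^ n := by rw [mul_sum]
      _ ≤ ε⁻¹ ^ m * ∑' n, (η + 1)⁻¹ ^ n := by
          gcongr
          exact hgeo.sum_le_tsum _ fun _ _ => by positivity
      _ = _ := mul_comm _ _

theorem sum_norm_coeff_pow_le {f : ℂ⟦X⟧} {c : ℝ} (K : ℕ)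
    (hf : ∑ n ∈ range K, ‖coeff n f‖ ≤ c) (m : ℕ) (hm : m ≠ 0) :
    ∑ n ∈ range K, ‖coeff n (f ^ m)‖ ≤ c ^ m := by
  induction m, Nat.one_le_iff_ne_zero.2 hm using Nat.le_induction with
  | base => simpa using hf
  | succ m h ih =>
    rw [pow_succ, pow_succ]
    have h0 : 0 ≤ ∑ n ∈ range K, ‖coeff n f‖ := by positivity
    exact (sum_norm_coeff_mul_le _ _ K).trans (mul_le_mul (ih (by omega)) hf h0
      (pow_nonneg (h0.trans hf) _))

/-- An `ℓ¹` perturbation of `1` of norm at most `1/2` has its inverse in `ℓ¹`: from `j = 1 + e j`,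
every truncated norm of `j` is at most `1` plus half of itself. -/
theorem absSum_of_one_sub_mul_eq_one {e j : ℂ⟦X⟧}
    (he : ∀ K, ∑ n ∈ range K, ‖coeff n e‖ ≤ 1 / 2) (hj : (1 - e) * j = 1) : AbsSum j := by
  refine absSum_of_bound (c := 2) fun K => ?_
  have h1 : j = 1 + e * j := by linear_combination hj
  have h2 : ∑ n ∈ range K, ‖coeff n j‖ ≤ ∑ n ∈ range K, ‖coeff n (1 : ℂ⟦X⟧)‖
      + ∑ n ∈ range K, ‖coeff n (e * j)‖ := by
    rw [← sum_add_distrib]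
    refine sum_le_sum fun n _ => ?_
    conv_lhs => rw [h1, map_add]
    exact norm_add_le _ _
  have h3 : ∑ n ∈ range K, ‖coeff n (1 : ℂ⟦X⟧)‖ ≤ 1 := by
    refine (absSum_one.sum_le K).trans (le_of_eq ?_)
    rw [tsum_eq_single 0 (fun n hn => by simp [coeff_one, hn])]
    simp
  have h4 := sum_norm_coeff_mul_le e j K
  have h5 := mul_le_mul_of_nonneg_right (he K)
    (sum_nonneg fun n _ => norm_nonneg _ : (0 : ℝ) ≤ ∑ n ∈ range K, ‖coeff n j‖)
  linarith

theorem exists_polynomial_sum_norm_sub_le {f : ℂ⟦X⟧} (hf : AbsSum f) {ε : ℝ} (hε : 0 < ε) :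
    ∃ p : Polynomial ℂ, ∀ K, ∑ n ∈ range K, ‖coeff n (f - (p : ℂ⟦X⟧))‖ ≤ ε := by
  have h := (tendsto_sum_nat_add fun n => ‖coeff n f‖).eventually (gt_mem_nhds hε)
  obtain ⟨N, hN⟩ := h.exists
  refine ⟨trunc N f, fun K => ?_⟩
  have hc : ∀ n, coeff n (f - (trunc N f : ℂ⟦X⟧)) = if n < N then 0 else coeff n f := by
    intro n
    rw [map_sub, Polynomial.coeff_coe, coeff_trunc]
    split_ifs <;> simp
  have hs : Summable fun n => ‖coeff n (f - (trunc N f : ℂ⟦X⟧))‖ := hf.sub (absSum_coe _)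
  refine (hs.sum_le_tsum _ fun _ _ => norm_nonneg _).trans (le_trans (le_of_eq ?_) hN.le)
  rw [← hs.sum_add_tsum_nat_add N, sum_eq_zero, zero_add]
  · exact tsum_congr fun n => by rw [hc, if_neg (by omega)]
  · intro n hn
    rw [hc, if_pos (mem_range.1 hn), norm_zero]

theorem norm_ev_le {f : ℂ⟦X⟧} {c : ℝ} (hf : ∀ K, ∑ n ∈ range K, ‖coeff n f‖ ≤ c) {z : ℂ}
    (hz : ‖z‖ ≤ 1) : ‖ev f z‖ ≤ c := by
  have h := (absSum_of_bound hf).summable_norm_eval hz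
  refine (norm_tsum_le_tsum_norm h).trans (h.tsum_le_of_sum_range_le fun K => ?_)
  refine le_trans (sum_le_sum fun n _ => ?_) (hf K)
  rw [norm_mul, norm_pow]
  exact mul_le_of_le_one_right (norm_nonneg _) (pow_le_one₀ (norm_nonneg _) hz)

/-- **Wiener's lemma** for power series: an `ℓ¹` series without zeros in the closed unit disc is
invertible in `ℓ¹`. With a truncation `p` of `f`, `t = p - f` and `q = 1 / p`, one has
`f q = 1 - t q`, so `f` times a geometric sum is `1 - (t q)^m`, and `(t q)^m` has norm at most `1/2`
for large `m`. -/
theorem AbsSum.exists_mul_eq_one {f : ℂ⟦X⟧} (hf : AbsSum f)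
    (h0 : ∀ z : ℂ, ‖z‖ ≤ 1 → ev f z ≠ 0) : ∃ g, AbsSum g ∧ f * g = 1 := by
  obtain ⟨z₀, hz₀, hmin⟩ := (isCompact_closedBall (0 : ℂ) 1).exists_isMinOn
    ⟨0, by simp⟩ hf.continuousOn_ev.norm
  have hε : 0 < ‖ev f z₀‖ := norm_pos_iff.2 (h0 z₀ (by simpa using hz₀))
  -- `‖t‖ ≤ ε` while `|p| ≥ 4 ε - ε > 2 ε`, so that `‖(t q)^m‖ ≤ c 2⁻ᵐ`.
  obtain ⟨ε, hε', hε4⟩ : ∃ ε : ℝ, 0 < ε ∧ 4 * ε = ‖ev f z₀‖ :=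
    ⟨‖ev f z₀‖ / 4, by positivity, by ring⟩
  obtain ⟨p, hp⟩ := exists_polynomial_sum_norm_sub_le hf hε'
  have hpe : ∀ z : ℂ, ‖z‖ ≤ 1 → 2 * ε < ‖p.eval z‖ := by
    intro z hz
    have h1 : ‖ev f z₀‖ ≤ ‖ev f z‖ := hmin (show z ∈ Metric.closedBall 0 1 by simpa using hz)
    have h2 := norm_ev_le hp hz
    rw [hf.ev_sub (absSum_coe p) hz, ev_coe] at h2
    have h3 := norm_sub_norm_le (ev f z) (p.eval z)
    linarith
  obtain ⟨q, c, hpq, hc, hq⟩ := exists_inverse_polynomial (by positivity) hpe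
  have hqs : AbsSum q := absSum_of_bound fun K => by simpa using hq 1 K
  set t : ℂ⟦X⟧ := (p : ℂ⟦X⟧) - f with ht
  have htK : ∀ K, ∑ n ∈ range K, ‖coeff n t‖ ≤ ε := by
    intro K
    have h : ∀ n, ‖coeff n t‖ = ‖coeff n (f - (p : ℂ⟦X⟧))‖ := fun n => by
      rw [ht, ← neg_sub f, map_neg, norm_neg]
    simpa only [h] using hp K
  have hts : AbsSum t := absSum_of_bound htK
  obtain ⟨m, hm0, hm⟩ : ∃ m : ℕ, m ≠ 0 ∧ c * (1 / 2 : ℝ) ^ m ≤ 1 / 2 := by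
    have h1 : Tendsto (fun m : ℕ => c * (1 / 2 : ℝ) ^ m) atTop (𝓝 (c * 0)) :=
      (tendsto_pow_atTop_nhds_zero_of_lt_one (by norm_num) (by norm_num)).const_mul c
    rw [mul_zero] at h1
    obtain ⟨m, h2, h3⟩ := ((h1.eventually (ge_mem_nhds (by norm_num : (0 : ℝ) < 1 / 2))).and
      (eventually_ge_atTop 1)).exists
    exact ⟨m, by omega, h2⟩
  have he : ∀ K, ∑ n ∈ range K, ‖coeff n ((t * q) ^ m)‖ ≤ 1 / 2 := by
    intro K
    rw [mul_pow]
    refine (sum_norm_coeff_mul_le _ _ K).trans (le_trans ?_ hm)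
    calc _ ≤ ε ^ m * (c * (2 * ε)⁻¹ ^ m) :=
          mul_le_mul (sum_norm_coeff_pow_le K (htK K) m hm0) (hq m K) (by positivity)
            (by positivity)
      _ = c * (1 / 2 : ℝ) ^ m := by
          rw [mul_left_comm, ← mul_pow]
          congr 2
          field_simp
  have hft : f * q = 1 - t * q := by rw [ht]; linear_combination hpq
  have hgeo : f * (q * ∑ i ∈ range m, (t * q) ^ i) = 1 - (t * q) ^ m := by
    rw [← mul_assoc, hft, mul_comm, geom_sum_mul_neg]
  have hc0 : constantCoeff (1 - (t * q) ^ m) ≠ 0 := by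
    intro h
    have h1 := he 1
    rw [map_sub, map_one, sub_eq_zero] at h
    simp [← h] at h1
    norm_num at h1
  have hinv : (1 - (t * q) ^ m) * (1 - (t * q) ^ m)⁻¹ = 1 := PowerSeries.mul_inv_cancel _ hc0
  refine ⟨(q * ∑ i ∈ range m, (t * q) ^ i) * (1 - (t * q) ^ m)⁻¹, ?_, ?_⟩
  · refine (hqs.mul ?_).mul (absSum_of_one_sub_mul_eq_one he hinv)
    clear hgeo hinv he hc0 hm hm0
    induction m with
    | zero => simpa using absSum_C 0
    | succ m ih => rw [sum_range_succ]; exact ih.add ((hts.mul hqs).pow m)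
  · rw [← mul_assoc, hgeo, hinv]

/-! ### Binomial series and the generating function -/

/-- The series of `(1 - z)^α`. -/
def oneSubPow (α : ℝ) : ℂ⟦X⟧ := rescale (-1) (PowerSeries.binomialSeries ℂ α)

/-- The (real) coefficients of `(1 - z)^α`. -/
def powCoeff (α : ℝ) (n : ℕ) : ℝ := (-1) ^ n * Ring.choose α n

theorem coeff_binomialSeries (α : ℝ) (n : ℕ) :
    coeff n (PowerSeries.binomialSeries ℂ α) = ((Ring.choose α n : ℝ) : ℂ) := by
  simp

theorem coeff_oneSubPow (α : ℝ) (n : ℕ) : coeff n (oneSubPow α) = (powCoeff α n : ℂ) := by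
  simp [oneSubPow, coeff_rescale, powCoeff]

theorem oneSubPow_add (α α' : ℝ) : oneSubPow (α + α') = oneSubPow α * oneSubPow α' := by
  simp [oneSubPow]

theorem oneSubPow_natCast (d : ℕ) : oneSubPow d = (1 - X) ^ d := by
  rw [oneSubPow, PowerSeries.binomialSeries_nat, map_pow, map_add, map_one, rescale_X]
  simp [sub_eq_add_neg]

theorem oneSubPow_zero : oneSubPow 0 = 1 := by simpa using oneSubPow_natCast 0

theorem oneSubPow_one : oneSubPow 1 = 1 - X := by simpa using oneSubPow_natCast 1

theorem oneSubPow_neg_mul_self (α : ℝ) : oneSubPow (-α) * oneSubPow α = 1 := by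
  rw [← oneSubPow_add, neg_add_cancel, oneSubPow_zero]

theorem powCoeff_zero (α : ℝ) : powCoeff α 0 = 1 := by simp [powCoeff]

theorem powCoeff_succ (α : ℝ) (n : ℕ) :
    (n + 1) * powCoeff α (n + 1) = (n - α) * powCoeff α n := by
  have h : (n + 1) * Ring.choose α (n + 1) = (α - n) * Ring.choose α n := by
    rw [Ring.choose_eq_smul, Ring.choose_eq_smul, descPochhammer_succ_right, Polynomial.smeval_mul,
      Nat.factorial_succ]
    simp [Polynomial.smeval_natCast]
    field_simp
  rw [powCoeff, powCoeff, pow_succ]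
  linear_combination (-(-1) ^ n) * h

/-- For `0 < β < 1` all coefficients of `(1 - z)^β` but the first are negative, and their partial
sums have a closed form. -/
theorem sum_abs_powCoeff {β : ℝ} (hβ0 : 0 < β) (hβ1 : β < 1) (n : ℕ) :
    powCoeff β (n + 1) < 0 ∧
      ∑ j ∈ range (n + 1), |powCoeff β j| = 2 + (n + 1) / β * powCoeff β (n + 1) := by
  induction n with
  | zero =>
    have h := powCoeff_succ β 0
    simp [powCoeff_zero] at h ⊢
    rw [h]
    refine ⟨by linarith, ?_⟩
    field_simp
    norm_num
  | succ n ih =>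
    have h := powCoeff_succ β (n + 1)
    push_cast at h ⊢
    have h1 : (0 : ℝ) < n + 1 - β := by
      have : (0 : ℝ) ≤ n := n.cast_nonneg
      linarith
    refine ⟨?_, ?_⟩
    · have h2 : (n + 1 - β) * powCoeff β (n + 1) < 0 := mul_neg_of_pos_of_neg h1 ih.1
      rw [← h] at h2
      exact neg_of_mul_neg_right h2 (by positivity)
    · rw [sum_range_succ, ih.2, abs_of_neg ih.1]
      field_simp
      linear_combination -h

theorem sum_abs_powCoeff_le {β : ℝ} (hβ0 : 0 < β) (hβ1 : β < 1) (K : ℕ) :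
    ∑ j ∈ range K, |powCoeff β j| ≤ 2 := by
  cases K with
  | zero => simp
  | succ n =>
    obtain ⟨h1, h2⟩ := sum_abs_powCoeff hβ0 hβ1 n
    have h3 : (n + 1) / β * powCoeff β (n + 1) ≤ 0 :=
      mul_nonpos_of_nonneg_of_nonpos (by positivity) h1.le
    linarith

theorem absSum_oneSubPow {β : ℝ} (hβ0 : 0 < β) (hβ1 : β < 1) : AbsSum (oneSubPow β) :=
  absSum_of_bound (c := 2) fun K => by
    simpa [coeff_oneSubPow] using sum_abs_powCoeff_le hβ0 hβ1 K

theorem absSum_binomialSeries {β : ℝ} (hβ0 : 0 < β) (hβ1 : β < 1) :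
    AbsSum (PowerSeries.binomialSeries ℂ β) :=
  absSum_of_bound (c := 2) fun K => by
    simpa [powCoeff, abs_mul] using sum_abs_powCoeff_le hβ0 hβ1 K

theorem hasSum_binomialSeries (α : ℝ) {z : ℂ} (hz : ‖z‖ < 1) :
    HasSum (fun n => coeff n (PowerSeries.binomialSeries ℂ α) * z ^ n) ((1 + z) ^ (α : ℂ)) := by
  have h := (Complex.one_add_cpow_hasFPowerSeriesOnBall_zero (a := α)).hasSum (y := z) (by
    rw [← ENNReal.ofReal_one, Metric.eball_ofReal]; simpa using hz)
  simpa [_root_.binomialSeries, FormalMultilinearSeries.coeff_ofScalars, mul_comm,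
    Complex.ofReal_choose] using h

theorem hasSum_oneSubPow (α : ℝ) {z : ℂ} (hz : ‖z‖ < 1) :
    HasSum (fun n => coeff n (oneSubPow α) * z ^ n) ((1 - z) ^ (α : ℂ)) := by
  have h := hasSum_binomialSeries α (z := -z) (by simpa using hz)
  rw [← sub_eq_add_neg] at h
  refine h.congr_fun fun n => ?_
  rw [oneSubPow, coeff_rescale, neg_pow z]
  ring

/-- Values on the open disc of an absolutely summable series extend to the closed disc. -/
theorem AbsSum.ev_eq_of_continuousOn {f : ℂ⟦X⟧} (hf : AbsSum f) {F : ℂ → ℂ}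
    (hF : ContinuousOn F (Metric.closedBall 0 1)) (h : ∀ z : ℂ, ‖z‖ < 1 → ev f z = F z)
    {z : ℂ} (hz : ‖z‖ ≤ 1) : ev f z = F z := by
  have h1 : Set.EqOn (ev f) F (Metric.closedBall 0 1) := by
    refine Set.EqOn.of_subset_closure (s := Metric.ball 0 1) (fun z hz => h z (by simpa using hz))
      hf.continuousOn_ev hF Metric.ball_subset_closedBall ?_
    rw [closure_ball _ one_ne_zero]
  exact h1 (by simpa using hz)

theorem ev_oneSubPow {β : ℝ} (hβ0 : 0 < β) (hβ1 : β < 1) {z : ℂ} (hz : ‖z‖ ≤ 1) :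
    ev (oneSubPow β) z = (1 - z) ^ (β : ℂ) := by
  refine (absSum_oneSubPow hβ0 hβ1).ev_eq_of_continuousOn (F := fun z => (1 - z) ^ (β : ℂ))
    (fun z hz => ?_) (fun z hz => (hasSum_oneSubPow β hz).tsum_eq) hz
  have h1 : z.re ≤ 1 := (Complex.re_le_norm z).trans (by simpa using hz)
  have h2 : ContinuousAt (fun w : ℂ => w ^ (β : ℂ)) (1 - z) :=
    Complex.continuousAt_cpow_const_of_re_pos (Or.inl (by simpa using h1)) (by simpa using hβ0)
  have h3 : ContinuousAt (fun w : ℂ => 1 - w) z := by fun_prop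
  exact (ContinuousAt.comp (f := fun w : ℂ => 1 - w) h2 h3).continuousWithinAt

/-- The series of `((1 + z) / 2)^β`. -/
def halfPow (β : ℝ) : ℂ⟦X⟧ := C (((1 / 2 : ℝ) ^ β : ℝ) : ℂ) * PowerSeries.binomialSeries ℂ β

theorem absSum_halfPow {β : ℝ} (hβ0 : 0 < β) (hβ1 : β < 1) : AbsSum (halfPow β) :=
  (absSum_C _).mul (absSum_binomialSeries hβ0 hβ1)

theorem mul_cpow_of_arg {a b : ℂ} (ha : a ≠ 0) (hb : b ≠ 0)
    (h : a.arg + b.arg ∈ Set.Ioc (-Real.pi) Real.pi) (s : ℂ) : (a * b) ^ s = a ^ s * b ^ s := by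
  rw [Complex.cpow_def_of_ne_zero (mul_ne_zero ha hb), Complex.cpow_def_of_ne_zero ha,
    Complex.cpow_def_of_ne_zero hb, (Complex.log_mul_eq_add_log_iff ha hb).2 h, add_mul,
    Complex.exp_add]

theorem half_mul_cpow {β : ℝ} (hβ : β ≠ 0) (w : ℂ) :
    ((1 / 2) * w) ^ (β : ℂ) = (((1 / 2 : ℝ) ^ β : ℝ) : ℂ) * w ^ (β : ℂ) := by
  rcases eq_or_ne w 0 with rfl | hw
  · simp [hβ]
  have h : ((1 / 2 : ℝ) : ℂ).arg = 0 := Complex.arg_ofReal_of_nonneg (by norm_num)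
  have h1 : (1 / 2 : ℂ) = ((1 / 2 : ℝ) : ℂ) := by norm_num
  rw [h1, mul_cpow_of_arg (by norm_num) hw ?_, Complex.ofReal_cpow (by norm_num)]
  rw [h, zero_add]
  exact ⟨Complex.neg_pi_lt_arg w, Complex.arg_le_pi w⟩

theorem ev_halfPow {β : ℝ} (hβ0 : 0 < β) (hβ1 : β < 1) {z : ℂ} (hz : ‖z‖ ≤ 1) :
    ev (halfPow β) z = ((1 / 2) * (1 + z)) ^ (β : ℂ) := by
  refine (absSum_halfPow hβ0 hβ1).ev_eq_of_continuousOn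
    (F := fun z => ((1 / 2) * (1 + z)) ^ (β : ℂ)) (fun z hz => ?_) (fun z hz => ?_) hz
  · have h1 : -1 ≤ z.re := by
      have h := (Complex.abs_re_le_norm z).trans (by simpa using hz)
      linarith [neg_abs_le z.re]
    have h2 : ContinuousAt (fun w : ℂ => w ^ (β : ℂ)) ((1 / 2) * (1 + z)) :=
      Complex.continuousAt_cpow_const_of_re_pos (Or.inl (by simp; linarith)) (by simpa using hβ0)
    have h3 : ContinuousAt (fun w : ℂ => (1 / 2) * (1 + w)) z := by fun_prop
    exact (ContinuousAt.comp (f := fun w : ℂ => (1 / 2) * (1 + w)) h2 h3).continuousWithinAt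
  · rw [halfPow, (absSum_C _).ev_mul (absSum_binomialSeries hβ0 hβ1) hz.le, ev_C,
      half_mul_cpow hβ0.ne', ← (hasSum_binomialSeries β hz).tsum_eq]
    rfl

/-- With numerator and denominator in the right half-plane no branch cut is crossed. -/
theorem div_cpow_of_re {a b : ℂ} (ha : 0 ≤ a.re) (hb : 0 < b.re) {s : ℂ} (hs : s ≠ 0) :
    (a / b) ^ s = a ^ s / b ^ s := by
  rcases eq_or_ne a 0 with rfl | ha0
  · simp [hs]
  have hb0 : b ≠ 0 := fun h => by simp [h] at hb
  have h1 := abs_le.1 (Complex.abs_arg_le_pi_div_two_iff.2 ha)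
  have h2 := abs_lt.1 (Complex.abs_arg_lt_pi_div_two_iff.2 (Or.inl hb))
  have h3 := Real.pi_pos
  have h4 : b.arg ≠ Real.pi := by linarith
  have h5 : b⁻¹.arg = -b.arg := by rw [Complex.arg_inv, if_neg h4]
  rw [div_eq_mul_inv, mul_cpow_of_arg ha0 (inv_ne_zero hb0) ?_, Complex.inv_cpow _ _ h4,
    div_eq_mul_inv]
  rw [h5]
  constructor <;> linarith

theorem re_lt_one {z : ℂ} (hz : ‖z‖ ≤ 1) (hz1 : z ≠ 1) : z.re < 1 := by
  refine lt_of_le_of_ne ((Complex.re_le_norm z).trans hz) fun h => hz1 ?_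
  have h1 := Complex.sq_norm_sub_sq_re z
  have h2 : ‖z‖ ^ 2 ≤ 1 := pow_le_one₀ (norm_nonneg _) hz
  have h3 : z.im = 0 := by
    rw [h] at h1
    nlinarith [sq_nonneg z.im]
  exact Complex.ext h h3

theorem genFun_eq {β : ℝ} (hβ : β ≠ 0) {z : ℂ} (hz : ‖z‖ ≤ 1) (hz1 : z ≠ 1) :
    genFun β z = ((1 / 2) * (1 + z)) ^ (β : ℂ) / (1 - z) ^ (β : ℂ) := by
  have h1 : -1 ≤ z.re := by
    have h := (Complex.abs_re_le_norm z).trans hz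
    linarith [neg_abs_le z.re]
  have h2 := re_lt_one hz hz1
  rw [genFun, ← mul_div_assoc, div_cpow_of_re]
  · simp; linarith
  · simp; linarith
  · simpa using hβ

/-- The weights `ω_j` are the coefficients of `(1 - z)^{-β} ((1 + z) / 2)^β`. -/
theorem omega_eq_coeff {β : ℝ} (hβ0 : 0 < β) (hβ1 : β < 1) (j : ℕ) :
    omega β j = coeff j (oneSubPow (-β) * halfPow β) := by
  rw [omega, coeff_eq_iteratedDeriv (F := genFun β) fun z hz => ?_]
  have h := hasSum_coeff_mul (hasSum_oneSubPow (-β) hz).summable.norm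
    ((absSum_halfPow hβ0 hβ1).summable_norm_eval hz.le)
  have hz1 : z ≠ 1 := fun h => by simp [h] at hz
  rw [genFun_eq hβ0.ne' hz.le hz1, div_eq_inv_mul, ← Complex.cpow_neg, ← ev_halfPow hβ0 hβ1 hz.le]
  rw [ev, (hasSum_oneSubPow (-β) hz).tsum_eq] at h
  simpa using h

theorem omega_zero_ne_zero (β : ℝ) : omega β 0 ≠ 0 := by
  have h : omega β 0 = genFun β 0 := by simp [omega]
  rw [h, genFun]
  simp

/-- An absolutely convergent series in `ℓ¹` has a sum in `ℓ¹`, and evaluation commutes with it. -/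
theorem exists_absSum_tsum {g : ℕ → ℂ⟦X⟧} {c : ℕ → ℝ} (hc : Summable c)
    (hg : ∀ j K, ∑ n ∈ range K, ‖coeff n (g j)‖ ≤ c j) :
    ∃ G, AbsSum G ∧ ∀ z : ℂ, ‖z‖ ≤ 1 → HasSum (fun j => ev (g j) z) (ev G z) := by
  have hgs : ∀ j, AbsSum (g j) := fun j => absSum_of_bound (hg j)
  have hs : Summable fun p : ℕ × ℕ => ‖coeff p.2 (g p.1)‖ := by
    refine (summable_prod_of_nonneg fun _ => norm_nonneg _).2 ⟨hgs, ?_⟩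
    exact Summable.of_nonneg_of_le (fun j => tsum_nonneg fun _ => norm_nonneg _)
      (fun j => (hgs j).tsum_le_of_sum_range_le (hg j)) hc
  refine ⟨PowerSeries.mk fun n => ∑' j, coeff n (g j), ?_, fun z hz => ?_⟩
  · have h1 := hs.prod_symm
    have h2 := ((summable_prod_of_nonneg fun _ => norm_nonneg _).1 h1)
    refine Summable.of_nonneg_of_le (fun _ => norm_nonneg _) (fun n => ?_) h2.2
    rw [coeff_mk]
    exact norm_tsum_le_tsum_norm (h2.1 n)
  · have h1 : Summable fun p : ℕ × ℕ => coeff p.2 (g p.1) * z ^ p.2 := by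
      refine Summable.of_norm_bounded hs fun p => ?_
      rw [norm_mul, norm_pow]
      exact mul_le_of_le_one_right (norm_nonneg _) (pow_le_one₀ (norm_nonneg _) hz)
    have h2 : ev (PowerSeries.mk fun n => ∑' j, coeff n (g j)) z
        = ∑' j, ev (g j) z := by
      simp only [ev, coeff_mk, ← tsum_mul_right]
      exact h1.tsum_comm
    rw [h2]
    exact (h1.prod).hasSum

/-- Second-order Taylor expansion of `((1 + z) / 2)^β` at `z = 1`, with summable remainder. It
comes from the binomial series in powers of `(1 - z) / 2`, a series of norm `1`. -/
theorem halfPow_eq {β : ℝ} (hβ0 : 0 < β) (hβ1 : β < 1) :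
    ∃ q, AbsSum q ∧ halfPow β = 1 - C (β / 2 : ℂ) * (1 - X) + (1 - X) ^ 2 * q := by
  have hX : AbsSum (1 - X) := absSum_one.sub absSum_X
  have hXK : ∀ K, ∑ n ∈ range K, ‖coeff n (1 - X : ℂ⟦X⟧)‖ ≤ 2 := by
    intro K
    refine (hX.sum_le K).trans (le_of_eq ?_)
    rw [tsum_eq_sum (s := range 2)]
    · norm_num [sum_range_succ, coeff_X, coeff_one]
    · intro n hn
      have h : n ≠ 0 ∧ n ≠ 1 := by constructor <;> rintro rfl <;> simp at hn
      simp [coeff_X, coeff_one, h]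
  -- `((1 + z) / 2)^β = ∑ choose β j (-1/2)^j (1 - z)^j`, and `q` collects the terms `j ≥ 2`.
  set a : ℕ → ℂ := fun j => (Ring.choose β (j + 2) : ℝ) * (-1 / 2) ^ (j + 2) with ha
  have hsum : Summable fun j => |powCoeff β (j + 2)| := by
    have h := absSum_oneSubPow hβ0 hβ1
    simp only [AbsSum, coeff_oneSubPow, Complex.norm_real, Real.norm_eq_abs] at h
    exact (summable_nat_add_iff 2).2 h
  obtain ⟨q, hq, hqev⟩ := exists_absSum_tsum (g := fun j => C (a j) * (1 - X) ^ j) hsum (by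
    intro j K
    simp only [coeff_C_mul, norm_mul, ← mul_sum]
    have h1 : ∑ n ∈ range K, ‖coeff n ((1 - X : ℂ⟦X⟧) ^ j)‖ ≤ 2 ^ j := by
      rcases eq_or_ne j 0 with rfl | hj
      · refine (absSum_one.sum_le K).trans (le_of_eq ?_)
        rw [tsum_eq_single 0 (fun n hn => by simp [coeff_one, hn])]
        simp
      · exact sum_norm_coeff_pow_le K (hXK K) j hj
    have h2 : ‖a j‖ = |powCoeff β (j + 2)| * (1 / 2) ^ (j + 2) := by
      simp [ha, powCoeff, abs_mul]
    rw [h2]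
    calc _ ≤ |powCoeff β (j + 2)| * (1 / 2) ^ (j + 2) * 2 ^ j := by gcongr
      _ = |powCoeff β (j + 2)| * (1 / 4) := by
        rw [mul_assoc, pow_add, mul_right_comm, ← mul_pow]; norm_num
      _ ≤ _ := by linarith [abs_nonneg (powCoeff β (j + 2))])
  refine ⟨q, hq, ?_⟩
  have hC := absSum_C (β / 2 : ℂ)
  refine (absSum_halfPow hβ0 hβ1).ext_ev
    ((absSum_one.sub (hC.mul hX)).add ((hX.pow 2).mul hq)) fun z hz => ?_
  have hz' := hz.le
  have hw : ‖(z - 1) / 2‖ < 1 := by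
    rw [norm_div]
    have := norm_sub_le z 1
    simp at this ⊢
    linarith
  have hb := hasSum_binomialSeries β hw
  rw [← hasSum_nat_add_iff' 2] at hb
  have hX' : ev (1 - X) z = 1 - z := by rw [absSum_one.ev_sub absSum_X hz', ev_one, ev_X]
  have hq' : HasSum (fun j => (1 - z) ^ 2 * ev (C (a j) * (1 - X) ^ j) z)
      ((1 - z) ^ 2 * ev q z) := (hqev z hz').mul_left _
  have heq : (fun j => (1 - z) ^ 2 * ev (C (a j) * (1 - X) ^ j) z) = fun j =>
      coeff (j + 2) (PowerSeries.binomialSeries ℂ β) * ((z - 1) / 2) ^ (j + 2) := by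
    funext j
    rw [(absSum_C _).ev_mul (hX.pow j) hz', hX.ev_pow hz', ev_C, hX', coeff_binomialSeries, ha,
      show (z - 1) / 2 = (-1 / 2) * (1 - z) by ring, mul_pow]
    ring
  rw [heq] at hq'
  have h1 := hq'.unique hb
  rw [ev_halfPow hβ0 hβ1 hz', (absSum_one.sub (hC.mul hX)).ev_add ((hX.pow 2).mul hq) hz',
    absSum_one.ev_sub (hC.mul hX) hz', hC.ev_mul hX hz', (hX.pow 2).ev_mul hq hz', hX.ev_pow hz',
    ev_one, ev_C, hX', h1, show (1 / 2 : ℂ) * (1 + z) = 1 + (z - 1) / 2 by ring]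
  simp [sum_range_succ]
  ring

/-! ### Expansion of powers in binomial coefficients -/

theorem powCoeff_add_one (α : ℝ) (n : ℕ) :
    (n - α - 1) * powCoeff (α + 1) n = (-α - 1) * powCoeff α n := by
  induction n with
  | zero => simp [powCoeff_zero]
  | succ n ih =>
    have h1 := powCoeff_succ α n
    have h2 := powCoeff_succ (α + 1) n
    have h3 : (n + 1 : ℝ) ≠ 0 := by positivity
    apply mul_left_cancel₀ h3
    push_cast
    linear_combination (n + 1 - α - 1) * h2 + (n - α) * ih - (-α - 1) * h1

theorem factorial_mul_powCoeff (s : ℝ) (n : ℕ) :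
    (n.factorial : ℝ) * powCoeff (-(s + 1)) n = ∏ j ∈ range n, (s + 1 + j) := by
  induction n with
  | zero => simp [powCoeff_zero]
  | succ n ih =>
    rw [prod_range_succ, ← ih, Nat.factorial_succ]
    have h := powCoeff_succ (-(s + 1)) n
    push_cast
    linear_combination (n.factorial : ℝ) * h

theorem powCoeff_pos {s : ℝ} (hs : 0 ≤ s) (n : ℕ) : 0 < powCoeff (-(s + 1)) n := by
  have h := factorial_mul_powCoeff s n
  have h1 : 0 < ∏ j ∈ range n, (s + 1 + j) := prod_pos fun j _ => by positivity
  rw [← h] at h1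
  exact pos_of_mul_pos_right h1 (by positivity)

theorem tendsto_powCoeff_div_rpow {s : ℝ} (hs : 0 ≤ s) :
    Tendsto (fun n : ℕ => powCoeff (-(s + 1)) n / (n : ℝ) ^ s) atTop
      (𝓝 (1 / Real.Gamma (s + 1))) := by
  have h1 := (Real.GammaSeq_tendsto_Gamma (s + 1)).inv₀ (Real.Gamma_pos_of_pos (by linarith)).ne'
  have h2 : Tendsto (fun n : ℕ => (n : ℝ) / (n + (s + 1))) atTop (𝓝 1) :=
    tendsto_natCast_div_add_atTop (s + 1)
  have h3 := h1.mul h2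
  rw [mul_one, inv_eq_one_div] at h3
  refine h3.congr' ?_
  filter_upwards [eventually_gt_atTop 0] with n hn
  have hn' : (0 : ℝ) < n := by exact_mod_cast hn
  have h4 := factorial_mul_powCoeff s n
  have hb := powCoeff_pos hs n
  have hr : (0 : ℝ) < (n : ℝ) ^ s := by positivity
  have hf : (0 : ℝ) < n.factorial := by positivity
  rw [Real.GammaSeq, prod_range_succ, ← h4, Real.rpow_add hn', Real.rpow_one]
  field_simp
  ring

/-- Three terms of the expansion of `n^s / Γ(s+1)` in binomial coefficients: the coefficients of
`y^{-s-1} (1 - (s+1)/2 y + (s+1)(3s-2)/24 y²)`, `y = 1 - z`. They are the first terms of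
`(-log z)^{-s-1}`, the leading singularity of `∑ n^s z^n / Γ(s+1)` at `z = 1`. -/
def powExpansion (s : ℝ) (n : ℕ) : ℝ :=
  powCoeff (-(s + 1)) n - (s + 1) / 2 * powCoeff (-s) n
    + (s + 1) * (3 * s - 2) / 24 * powCoeff (1 - s) n

/-- The polynomial in `t = n` for which
`(n + s) (n + s - 1) powExpansion s n = expansionNum s n * powCoeff (-(s + 1)) n`. -/
def expansionNum (s t : ℝ) : ℝ :=
  (t + s) * (t + s - 1) - s * (s + 1) / 2 * (t + s - 1)
    + (s + 1) * (3 * s - 2) / 24 * (s * (s - 1))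

theorem powExpansion_mul (s : ℝ) (n : ℕ) :
    (n + s) * (n + s - 1) * powExpansion s n = expansionNum s n * powCoeff (-(s + 1)) n := by
  have h1 := powCoeff_add_one (-(s + 1)) n
  have h2 := powCoeff_add_one (-s) n
  rw [show -(s + 1) + 1 = -s by ring] at h1
  rw [show -s + 1 = 1 - s by ring] at h2
  rw [powExpansion, expansionNum]
  linear_combination (-(n + s - 1) * (s + 1) / 2
    + (s + 1) * (3 * s - 2) / 24 * (s - 1)) * h1
    + (s + 1) * (3 * s - 2) / 24 * (n + s) * h2

/-- The two-term recursion of the expansion. It avoids both the Gamma function and powers, and is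
compared with the recursion `(1 + 1/n)^s` of `n^s`. -/
theorem powExpansion_succ {s : ℝ} (hs : 0 ≤ s) {n : ℕ} (hn : 1 ≤ n) :
    (n + 1) * expansionNum s n * powExpansion s (n + 1)
      = expansionNum s (n + 1) * (n + s - 1) * powExpansion s n := by
  have hn' : (1 : ℝ) ≤ n := by exact_mod_cast hn
  have h1 := powExpansion_mul s n
  have h2 := powExpansion_mul s (n + 1)
  have h3 := powCoeff_succ (-(s + 1)) n
  push_cast at h2
  have h4 : (n + 1 + s) * (n + s) ≠ 0 := by positivity
  apply mul_left_cancel₀ h4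
  linear_combination (n + 1) * expansionNum s n * h2 - (n + 1 + s) * expansionNum s (n + 1) * h1
    + expansionNum s n * expansionNum s (n + 1) * h3

theorem one_add_rpow_taylor (s : ℝ) :
    (fun x : ℝ => (1 + x) ^ s
      - (1 + s * x + s * (s - 1) / 2 * x ^ 2 + s * (s - 1) * (s - 2) / 6 * x ^ 3))
      =O[𝓝 0] fun x => x ^ 4 := by
  have h := (Real.one_add_rpow_hasFPowerSeriesAt_zero (a := s)).isBigO_sub_partialSum_pow 4
  have h0 : ∀ n : ℕ, ((n + 1 : ℕ) : ℝ) * Ring.choose s (n + 1) = (s - n) * Ring.choose s n := by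
    intro n
    have h := powCoeff_succ s n
    rw [powCoeff, powCoeff, pow_succ] at h
    have h1 : ((-1 : ℝ) ^ n) ≠ 0 := by positivity
    apply mul_left_cancel₀ h1
    push_cast
    linear_combination -h
  have c1 : Ring.choose s 1 = s := by simp
  have c2 : Ring.choose s 2 = s * (s - 1) / 2 := by
    have := h0 1; rw [c1] at this; push_cast at this; linarith
  have c3 : Ring.choose s 3 = s * (s - 1) * (s - 2) / 6 := by
    have := h0 2; rw [c2] at this; push_cast at this; linarith
  have h2 : (fun x : ℝ => (1 + x) ^ s
      - (1 + s * x + s * (s - 1) / 2 * x ^ 2 + s * (s - 1) * (s - 2) / 6 * x ^ 3))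
      = fun x : ℝ => (1 + (0 + x)) ^ s - (_root_.binomialSeries ℝ s).partialSum 4 x := by
    funext x
    simp [FormalMultilinearSeries.partialSum, sum_range_succ, c2, c3, _root_.binomialSeries,
      FormalMultilinearSeries.coeff_ofScalars]
    ring
  rw [h2]
  refine h.trans (Asymptotics.isBigO_of_le _ fun x => ?_)
  simp

/-- The growth ratios of `powExpansion s n` and of `n^s` agree up to `O(n⁻⁴)`. With `x = 1/n` the
first is the rational function `Q(x) / P(x)`; the coefficient `(s+1)(3s-2)/24` is the one for which
`Q - P T` vanishes to fourth order, `T` being the cubic Taylor polynomial of `(1 + x)^s`. -/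
theorem ratio_isBigO (s : ℝ) :
    (fun n : ℕ => (n : ℝ)⁻¹ ^ 3 * (expansionNum s (n + 1) * (n + s - 1)
      - (n + 1) * expansionNum s n * (1 + (n : ℝ)⁻¹) ^ s))
      =O[atTop] fun n : ℕ => (n : ℝ)⁻¹ ^ 4 := by
  set κ : ℝ := (s + 1) * (3 * s - 2) / 24 with hκ
  set P : ℝ → ℝ := fun x => (1 + x) * ((1 + s * x) * (1 + (s - 1) * x)
    - s * (s + 1) / 2 * x * (1 + (s - 1) * x) + κ * (s * (s - 1)) * x ^ 2) with hP
  set Q : ℝ → ℝ := fun x => ((1 + (s + 1) * x) * (1 + s * x)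
    - s * (s + 1) / 2 * x * (1 + s * x) + κ * (s * (s - 1)) * x ^ 2) * (1 + (s - 1) * x) with hQ
  set T : ℝ → ℝ := fun x =>
    1 + s * x + s * (s - 1) / 2 * x ^ 2 + s * (s - 1) * (s - 2) / 6 * x ^ 3 with hT
  have hx : Tendsto (fun n : ℕ => (n : ℝ)⁻¹) atTop (𝓝 0) := tendsto_inv_atTop_nhds_zero_nat
  have hbd : ∀ F : ℝ → ℝ, Continuous F → F =O[𝓝 0] fun _ => (1 : ℝ) := fun F hF =>
    (hF.tendsto 0).isBigO_one ℝ
  have hr : ∃ r : ℝ → ℝ, Continuous r ∧ ∀ x, Q x - P x * T x = x ^ 4 * r x := by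
    refine ⟨fun x => (-1 / 2 * s + 23 / 24 * s ^ 2 - 5 / 16 * s ^ 3 - 19 / 48 * s ^ 4
      + 5 / 16 * s ^ 5 - 1 / 16 * s ^ 6)
      + (1 / 3 * s - 77 / 72 * s ^ 2 + 59 / 48 * s ^ 3 - 19 / 36 * s ^ 4 - 1 / 24 * s ^ 5
        + 7 / 72 * s ^ 6 - 1 / 48 * s ^ 7) * x
      + (5 / 36 * s ^ 2 - 1 / 2 * s ^ 3 + 101 / 144 * s ^ 4 - 23 / 48 * s ^ 5 + 23 / 144 * s ^ 6
        - 1 / 48 * s ^ 7) * x ^ 2, by fun_prop, fun x => ?_⟩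
    simp only [hP, hQ, hT, hκ]
    ring
  obtain ⟨r, hrc, hr⟩ := hr
  have hmain : (fun x : ℝ => Q x - P x * (1 + x) ^ s) =O[𝓝 0] fun x => x ^ 4 := by
    have h1 : (fun x : ℝ => x ^ 4 * r x) =O[𝓝 0] fun x : ℝ => x ^ 4 := by
      simpa using (Asymptotics.isBigO_refl (fun x : ℝ => x ^ 4) (𝓝 0)).mul (hbd r hrc)
    have h2 : (fun x : ℝ => P x * ((1 + x) ^ s - T x)) =O[𝓝 0] fun x : ℝ => x ^ 4 := by
      simpa using (hbd P (by fun_prop)).mul (one_add_rpow_taylor s)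
    refine (h1.sub h2).congr_left fun x => ?_
    rw [← hr]
    ring
  refine (hmain.comp_tendsto hx).congr' ?_ (Eventually.of_forall fun n => rfl)
  filter_upwards [eventually_gt_atTop 0] with n hn
  have hn' : (n : ℝ) ≠ 0 := by exact_mod_cast hn.ne'
  have e1 : (n : ℝ)⁻¹ ^ 3 * (expansionNum s (n + 1) * (n + s - 1)) = Q (n : ℝ)⁻¹ := by
    simp only [hQ, expansionNum]
    field_simp
    ring
  have e2 : (n : ℝ)⁻¹ ^ 3 * ((n + 1) * expansionNum s n) = P (n : ℝ)⁻¹ := by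
    simp only [hP, expansionNum]
    field_simp
    ring
  simp only [Function.comp]
  rw [← e1, ← e2]
  ring

/-- A convergent sequence with increments `O(n⁻⁴)` approaches its limit like `n⁻³`. -/
theorem abs_sub_limit_le {u : ℕ → ℝ} {L c : ℝ} {N : ℕ} (hL : Tendsto u atTop (𝓝 L)) (hN : 1 ≤ N)
    (hu : ∀ n ≥ N, |u (n + 1) - u n| ≤ c * (n : ℝ)⁻¹ ^ 4) {n : ℕ} (hn : N ≤ n) :
    |L - u n| ≤ 3 * c * (n : ℝ)⁻¹ ^ 3 := by
  have hc : 0 ≤ c := by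
    have h := (abs_nonneg _).trans (hu N le_rfl)
    exact nonneg_of_mul_nonneg_left h (by positivity)
  have step : ∀ m : ℕ, 1 ≤ m →
      (m : ℝ)⁻¹ ^ 4 ≤ 3 * ((m : ℝ)⁻¹ ^ 3 - ((m : ℝ) + 1)⁻¹ ^ 3) := by
    intro m hm
    have hm' : (1 : ℝ) ≤ m := by exact_mod_cast hm
    have h0 : (0 : ℝ) < m := by linarith
    have e : 3 * ((m : ℝ)⁻¹ ^ 3 - ((m : ℝ) + 1)⁻¹ ^ 3) - (m : ℝ)⁻¹ ^ 4
        = (8 * m ^ 3 + 6 * m ^ 2 - 1) / (m ^ 4 * (m + 1) ^ 3) := by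
      field_simp
      ring
    have h1 : (0 : ℝ) ≤ 8 * m ^ 3 + 6 * m ^ 2 - 1 := by nlinarith [pow_pos h0 3]
    have h2 : (0 : ℝ) ≤ (8 * m ^ 3 + 6 * m ^ 2 - 1) / (m ^ 4 * (m + 1) ^ 3) := by positivity
    linarith
  have htel : ∀ m ≥ n, |u m - u n| ≤ 3 * c * ((n : ℝ)⁻¹ ^ 3 - (m : ℝ)⁻¹ ^ 3) := by
    intro m hm
    induction m, hm using Nat.le_induction with
    | base => simp
    | succ m hm ih =>
      have h1 := hu m (hn.trans hm)
      have h2 := mul_le_mul_of_nonneg_left (step m (by omega)) hc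
      have h3 := abs_sub_le (u (m + 1)) (u m) (u n)
      push_cast
      linarith
  refine le_of_tendsto ((hL.sub_const (u n)).abs) ?_
  filter_upwards [eventually_ge_atTop n] with m hm
  refine (htel m hm).trans ?_
  have h1 : (0 : ℝ) ≤ (m : ℝ)⁻¹ ^ 3 := by positivity
  nlinarith

theorem tendsto_powExpansion_div_rpow {s : ℝ} (hs : 0 ≤ s) :
    Tendsto (fun n : ℕ => powExpansion s n / (n : ℝ) ^ s) atTop
      (𝓝 (1 / Real.Gamma (s + 1))) := by
  have hx : Tendsto (fun n : ℕ => (n : ℝ)⁻¹) atTop (𝓝 0) := tendsto_inv_atTop_nhds_zero_nat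
  have h1 : Tendsto (fun x : ℝ => ((1 + s * x) * (1 + (s - 1) * x)
      - s * (s + 1) / 2 * (x * (1 + (s - 1) * x))
      + (s + 1) * (3 * s - 2) / 24 * (s * (s - 1)) * x ^ 2)
      / ((1 + s * x) * (1 + (s - 1) * x))) (𝓝 0) (𝓝 1) := by
    have h : ContinuousAt (fun x : ℝ => ((1 + s * x) * (1 + (s - 1) * x)
      - s * (s + 1) / 2 * (x * (1 + (s - 1) * x))
      + (s + 1) * (3 * s - 2) / 24 * (s * (s - 1)) * x ^ 2)
      / ((1 + s * x) * (1 + (s - 1) * x))) 0 := by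
      refine ContinuousAt.div (by fun_prop) (by fun_prop) (by simp)
    simpa [ContinuousAt] using h
  have h2 := (h1.comp hx).mul (tendsto_powCoeff_div_rpow hs)
  rw [one_mul] at h2
  refine h2.congr' ?_
  filter_upwards [eventually_ge_atTop 2] with n hn
  have hn' : (2 : ℝ) ≤ n := by exact_mod_cast hn
  have hn0 : (n : ℝ) ≠ 0 := by positivity
  have h3 : (n + s : ℝ) ≠ 0 := by positivity
  have h4 : (n + s - 1 : ℝ) ≠ 0 := by linarith
  have h5 := powExpansion_mul s n
  have h6 : powExpansion s n
      = expansionNum s n / ((n + s) * (n + s - 1)) * powCoeff (-(s + 1)) n := by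
    field_simp
    linear_combination h5
  have e1 : 1 + s * (n : ℝ)⁻¹ = (n + s) * (n : ℝ)⁻¹ := by field_simp
  have e2 : 1 + (s - 1) * (n : ℝ)⁻¹ = (n + s - 1) * (n : ℝ)⁻¹ := by field_simp; ring
  simp only [Function.comp, h6]
  have hns : (n : ℝ) ^ s ≠ 0 := by positivity
  rw [e1, e2, expansionNum]
  field_simp

/-- The increments of `powExpansion s n / n^s` are `O(n⁻⁴)`. -/
theorem exists_increment_le {s : ℝ} (hs : 0 ≤ s) : ∃ (c : ℝ) (N : ℕ), 1 ≤ N ∧ ∀ n ≥ N,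
    |powExpansion s (n + 1) / ((n + 1 : ℕ) : ℝ) ^ s - powExpansion s n / (n : ℝ) ^ s|
      ≤ c * (n : ℝ)⁻¹ ^ 4 := by
  have hx : Tendsto (fun n : ℕ => (n : ℝ)⁻¹) atTop (𝓝 0) := tendsto_inv_atTop_nhds_zero_nat
  have hu := tendsto_powExpansion_div_rpow hs
  obtain ⟨d, hd⟩ := hu.abs.bddAbove_range
  have hd' : ∀ n : ℕ, |powExpansion s n / (n : ℝ) ^ s| ≤ d := fun n => hd ⟨n, rfl⟩
  obtain ⟨c, hc⟩ := (ratio_isBigO s).bound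
  have hP : Tendsto (fun n : ℕ => (n : ℝ)⁻¹ ^ 3 * ((n + 1) * expansionNum s n)) atTop (𝓝 1) := by
    have h1 : Tendsto (fun x : ℝ => (1 + x) * ((1 + s * x) * (1 + (s - 1) * x)
      - s * (s + 1) / 2 * (x * (1 + (s - 1) * x))
      + (s + 1) * (3 * s - 2) / 24 * (s * (s - 1)) * x ^ 2)) (𝓝 0) (𝓝 1) := by
      have h : Continuous (fun x : ℝ => (1 + x) * ((1 + s * x) * (1 + (s - 1) * x)
        - s * (s + 1) / 2 * (x * (1 + (s - 1) * x))
        + (s + 1) * (3 * s - 2) / 24 * (s * (s - 1)) * x ^ 2)) := by fun_prop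
      simpa using h.tendsto 0
    refine (h1.comp hx).congr' ?_
    filter_upwards [eventually_gt_atTop 0] with n hn
    have hn0 : (n : ℝ) ≠ 0 := by exact_mod_cast hn.ne'
    simp only [Function.comp, expansionNum]
    field_simp
    ring
  obtain ⟨N, hN⟩ := eventually_atTop.1 ((hc.and (hP.eventually (lt_mem_nhds
    (by norm_num : (1 / 2 : ℝ) < 1)))).and (eventually_ge_atTop 1))
  refine ⟨2 * c * d, N, (hN N le_rfl).2, fun n hn => ?_⟩
  obtain ⟨⟨h1, h2⟩, hn1⟩ := hN n hn
  have hn' : (1 : ℝ) ≤ n := by exact_mod_cast hn1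
  have hn0 : (0 : ℝ) < n := by linarith
  set w : ℝ := (n : ℝ)⁻¹ ^ 3 * ((n + 1) * expansionNum s n) with hw
  have hrec := powExpansion_succ hs hn1
  have hr : ((n + 1 : ℕ) : ℝ) ^ s = (n : ℝ) ^ s * (1 + (n : ℝ)⁻¹) ^ s := by
    rw [← Real.mul_rpow hn0.le (by positivity)]
    congr 1
    push_cast
    field_simp
  have hy : 1 ≤ (1 + (n : ℝ)⁻¹) ^ s :=
    Real.one_le_rpow (by have : 0 ≤ (n : ℝ)⁻¹ := by positivity
                         linarith) hs
  set y : ℝ := (1 + (n : ℝ)⁻¹) ^ s with hy'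
  have hns : (0 : ℝ) < (n : ℝ) ^ s := by positivity
  rw [Real.norm_eq_abs, Real.norm_eq_abs, abs_of_nonneg (by positivity : (0 : ℝ) ≤ (n : ℝ)⁻¹ ^ 4)]
    at h1
  have key : w * y * (powExpansion s (n + 1) / ((n + 1 : ℕ) : ℝ) ^ s
      - powExpansion s n / (n : ℝ) ^ s) = powExpansion s n / (n : ℝ) ^ s *
      ((n : ℝ)⁻¹ ^ 3 * (expansionNum s (n + 1) * (n + s - 1)
        - (n + 1) * expansionNum s n * y)) := by
    rw [hr, hw]
    have hy0 : y ≠ 0 := by linarith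
    field_simp
    linear_combination hrec
  have hwy : 1 / 2 ≤ w * y := by nlinarith
  have key2 := congrArg abs key
  rw [abs_mul, abs_mul (powExpansion s n / (n : ℝ) ^ s), abs_of_nonneg (by linarith : 0 ≤ w * y)]
    at key2
  have h3 := mul_le_mul (hd' n) h1 (abs_nonneg _) ((abs_nonneg _).trans (hd' n))
  have h4 := mul_le_mul_of_nonneg_right hwy (abs_nonneg
    (powExpansion s (n + 1) / ((n + 1 : ℕ) : ℝ) ^ s - powExpansion s n / (n : ℝ) ^ s))
  linarith

/-- The remainder is `O(n^{s-3})`. -/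
theorem summable_rpow_sub_powExpansion {s : ℝ} (hs : 0 ≤ s) (hs2 : s < 2) :
    Summable fun n : ℕ => |(n : ℝ) ^ s / Real.Gamma (s + 1) - powExpansion s n| := by
  obtain ⟨c, N, hN, hc⟩ := exists_increment_le hs
  have hL := tendsto_powExpansion_div_rpow hs
  refine Summable.of_norm_bounded_eventually_nat (g := fun n : ℕ => 3 * c * (n : ℝ) ^ (s - 3))
    ((Real.summable_nat_rpow.2 (by linarith)).mul_left _) ?_
  filter_upwards [eventually_ge_atTop N] with n hn
  have hn0 : (0 : ℝ) < n := by exact_mod_cast (hN.trans hn)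
  have h1 := abs_sub_limit_le hL hN hc hn
  have hns : (0 : ℝ) < (n : ℝ) ^ s := by positivity
  have e1 : (n : ℝ) ^ s / Real.Gamma (s + 1) - powExpansion s n
      = (n : ℝ) ^ s * (1 / Real.Gamma (s + 1) - powExpansion s n / (n : ℝ) ^ s) := by
    field_simp
  have e2 : (n : ℝ) ^ (s - 3) = (n : ℝ) ^ s * (n : ℝ)⁻¹ ^ 3 := by
    rw [Real.rpow_sub hn0, inv_pow, ← div_eq_mul_inv]
    norm_cast
  rw [e1, e2, Real.norm_eq_abs, abs_abs, abs_mul, abs_of_pos hns]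
  nlinarith

/-- At `s = 2`, where `n^{s-3}` is no longer summable, the expansion is exact. -/
theorem powExpansion_two (n : ℕ) : powExpansion 2 n = (n : ℝ) ^ 2 / 2 := by
  have h : ∀ n : ℕ, powCoeff (-1) n = 1 ∧ powCoeff (-2) n = n + 1 ∧
      powCoeff (-3) n = (n + 1) * (n + 2) / 2 := by
    intro n
    induction n with
    | zero => simp [powCoeff_zero]
    | succ n ih =>
      have h0 : (n + 1 : ℝ) ≠ 0 := by positivity
      have h1 := powCoeff_succ (-1) n
      have h2 := powCoeff_succ (-2) n
      have h3 := powCoeff_succ (-3) n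
      rw [ih.1] at h1
      rw [ih.2.1] at h2
      rw [ih.2.2] at h3
      refine ⟨mul_left_cancel₀ h0 ?_, mul_left_cancel₀ h0 ?_, mul_left_cancel₀ h0 ?_⟩
      · rw [h1]; ring
      · rw [h2]; push_cast; ring
      · rw [h3]; push_cast; ring
  obtain ⟨h1, h2, h3⟩ := h n
  rw [powExpansion, show -((2 : ℝ) + 1) = -3 by norm_num, show (1 : ℝ) - 2 = -1 by norm_num,
    h1, h2, h3]
  ring

/-- The series of the monomial sequence `n^s / Γ(s+1)`. -/
def powSeries (s : ℝ) : ℂ⟦X⟧ :=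
  PowerSeries.mk fun n => (((n : ℝ) ^ s / Real.Gamma (s + 1) : ℝ) : ℂ)

/-- Expansion of `∑ n^s z^n / Γ(s+1)` in powers of `1 - z`, up to an `ℓ¹` remainder. -/
theorem powSeries_eq {s : ℝ} (hs : 0 ≤ s) (hs2 : s ≤ 2) : ∃ ρ, AbsSum ρ ∧
    powSeries s = oneSubPow (-(s + 1)) - C (((s + 1) / 2 : ℝ) : ℂ) * oneSubPow (-s)
      + C (((s + 1) * (3 * s - 2) / 24 : ℝ) : ℂ) * oneSubPow (1 - s) + ρ := by
  refine ⟨powSeries s - PowerSeries.mk fun n => (powExpansion s n : ℂ), ?_, ?_⟩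
  · rcases hs2.lt_or_eq with h | rfl
    · refine (summable_rpow_sub_powExpansion hs h).congr fun n => ?_
      rw [map_sub, powSeries, coeff_mk, coeff_mk, ← Complex.ofReal_sub, Complex.norm_real,
        Real.norm_eq_abs]
    · have h : powSeries 2 = PowerSeries.mk fun n => (powExpansion 2 n : ℂ) := by
        ext n
        rw [powSeries, coeff_mk, coeff_mk, powExpansion_two, Real.Gamma_add_one two_ne_zero,
          Real.Gamma_two]
        norm_num
      rw [h, sub_self]
      simpa using absSum_C 0
  · ext n
    simp only [map_sub, map_add, coeff_C_mul, coeff_mk, coeff_oneSubPow, powExpansion]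
    push_cast
    ring

/-! ### Convergence of the starting weights -/

/-- The coefficients converge. -/
def Conv (f : ℂ⟦X⟧) : Prop := ∃ L : ℂ, Tendsto (fun n => coeff n f) atTop (𝓝 L)

theorem Conv.add {f g : ℂ⟦X⟧} (hf : Conv f) (hg : Conv g) : Conv (f + g) := by
  obtain ⟨a, ha⟩ := hf
  obtain ⟨b, hb⟩ := hg
  exact ⟨a + b, by simpa using ha.add hb⟩

theorem AbsSum.mul_conv {f g : ℂ⟦X⟧} (hf : AbsSum f) (hg : Conv g) : Conv (f * g) := by
  obtain ⟨L, hL⟩ := hg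
  exact ⟨_, hf.tendsto_coeff_mul hL⟩

theorem Conv.sub {f g : ℂ⟦X⟧} (hf : Conv f) (hg : Conv g) : Conv (f - g) := by
  obtain ⟨a, ha⟩ := hf
  obtain ⟨b, hb⟩ := hg
  exact ⟨a - b, by simpa using ha.sub hb⟩

theorem absSum_oneSubPow_of_nonneg {α : ℝ} (hα : 0 ≤ α) : AbsSum (oneSubPow α) := by
  have h : α = (⌊α⌋₊ : ℝ) + (α - ⌊α⌋₊) := by ring
  rw [h, oneSubPow_add, oneSubPow_natCast]
  refine ((absSum_one.sub absSum_X).pow _).mul ?_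
  rcases (sub_nonneg.2 (Nat.floor_le hα)).eq_or_lt with h0 | h0
  · rw [← h0, oneSubPow_zero]
    exact absSum_one
  · exact absSum_oneSubPow h0 (by linarith [Nat.lt_floor_add_one α])

theorem powCoeff_neg_one (n : ℕ) : powCoeff (-1) n = 1 := by
  induction n with
  | zero => exact powCoeff_zero _
  | succ n ih =>
    have h := powCoeff_succ (-1) n
    rw [ih] at h
    have h0 : (n + 1 : ℝ) ≠ 0 := by positivity
    exact mul_left_cancel₀ h0 (by linarith)

/-- For `-1 < α < 0` this holds because the coefficients are the partial sums of the `ℓ¹` series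
`(1 - z)^{α+1}`, which vanishes at `z = 1`. -/
theorem tendsto_coeff_oneSubPow {α : ℝ} (hα : -1 < α) :
    Tendsto (fun n => coeff n (oneSubPow α)) atTop (𝓝 0) := by
  rcases le_or_gt 0 α with h | h
  · exact (absSum_oneSubPow_of_nonneg h).tendsto_coeff
  · have h1 : oneSubPow α = oneSubPow (α + 1) * oneSubPow (-1) := by
      rw [← oneSubPow_add]; congr 1; ring
    have h2 := absSum_oneSubPow (β := α + 1) (by linarith) (by linarith)
    have h3 : ev (oneSubPow (α + 1)) 1 = 0 := by
      rw [ev_oneSubPow (by linarith) (by linarith) (by simp), sub_self, Complex.zero_cpow]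
      exact_mod_cast (by linarith : α + 1 ≠ 0)
    have h4 := h2.tendsto_coeff_mul (g := oneSubPow (-1)) (L := 1) (by
      simp [coeff_oneSubPow, powCoeff_neg_one])
    rwa [← h1, h3, zero_mul] at h4

theorem conv_oneSubPow {α : ℝ} (hα : -1 ≤ α) : Conv (oneSubPow α) := by
  rcases hα.eq_or_lt with rfl | h
  · exact ⟨1, by simp [coeff_oneSubPow, powCoeff_neg_one]⟩
  · exact ⟨0, tendsto_coeff_oneSubPow h⟩

/-- The generating series `ω^{(β)}`. -/
def omegaSeries (β : ℝ) : ℂ⟦X⟧ := oneSubPow (-β) * halfPow β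

/-- Up to the factor `Γ(θ+1)`, the error of the convolution quadrature for `t^θ` at step size `1`
converges. Expanding everything in powers of `1 - z`, the error starts with `(1 - z)^{1-θ-β}`, whose
coefficients converge exactly because `θ + β ≤ 2`. -/
theorem conv_quadrature_error {β θ : ℝ} (hβ0 : 0 < β) (hβ1 : β < 1) (hθ : 0 ≤ θ)
    (hθ2 : θ + β ≤ 2) : Conv (powSeries (θ + β) - powSeries θ * omegaSeries β) := by
  obtain ⟨q, hq, hH⟩ := halfPow_eq hβ0 hβ1
  obtain ⟨ρ, hρ, hp⟩ := powSeries_eq hθ (by linarith)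
  obtain ⟨ρ', hρ', hp'⟩ := powSeries_eq (s := θ + β) (by linarith) hθ2
  have hH1 := absSum_halfPow hβ0 hβ1
  set κ : ℂ := (((θ + 1) * (3 * θ - 2) / 24 : ℝ) : ℂ)
  set κ' : ℂ := (((θ + β + 1) * (3 * (θ + β) - 2) / 24 : ℝ) : ℂ)
  set σ := θ + β with hσ
  have e1 : oneSubPow (-(θ + 1)) * oneSubPow (-β) = oneSubPow (-(σ + 1)) := by
    rw [← oneSubPow_add]; congr 1; rw [hσ]; ring
  have e2 : oneSubPow (-θ) * oneSubPow (-β) = oneSubPow (-σ) := by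
    rw [← oneSubPow_add]; congr 1; rw [hσ]; ring
  have e3 : oneSubPow (1 - θ) * oneSubPow (-β) = oneSubPow (1 - σ) := by
    rw [← oneSubPow_add]; congr 1; rw [hσ]; ring
  have e4 : (1 - X) * oneSubPow (-(σ + 1)) = oneSubPow (-σ) := by
    rw [← oneSubPow_one, ← oneSubPow_add]; congr 1; ring
  have e5 : (1 - X) * oneSubPow (-σ) = oneSubPow (1 - σ) := by
    rw [← oneSubPow_one, ← oneSubPow_add]; congr 1
  have e6 : (1 - X) * oneSubPow (1 - σ) = oneSubPow (2 - σ) := by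
    rw [← oneSubPow_one, ← oneSubPow_add]; congr 1; ring
  have c1 : Conv (oneSubPow (1 - σ)) := conv_oneSubPow (by linarith)
  have c2 : Conv (oneSubPow (2 - σ)) := conv_oneSubPow (by linarith)
  have c3 : Conv (oneSubPow (-β)) := conv_oneSubPow (by linarith)
  have hC : C (((σ + 1) / 2 : ℝ) : ℂ) = C (((θ + 1) / 2 : ℝ) : ℂ) + C (β / 2 : ℂ) := by
    rw [← map_add, hσ]
    congr 1
    push_cast
    ring
  -- The terms in `(1 - X)^(-(σ+1))` and `(1 - X)^(-σ)` cancel.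
  have key : powSeries σ - powSeries θ * omegaSeries β
      = C κ' * oneSubPow (1 - σ) + ρ' - q * oneSubPow (1 - σ)
        - C (((θ + 1) / 2 : ℝ) : ℂ) * C (β / 2 : ℂ) * oneSubPow (1 - σ)
        + C (((θ + 1) / 2 : ℝ) : ℂ) * q * oneSubPow (2 - σ)
        - C κ * halfPow β * oneSubPow (1 - σ) - halfPow β * ρ * oneSubPow (-β) := by
    rw [hp, hp', omegaSeries, hC]
    linear_combination (-halfPow β) * e1 + C (((θ + 1) / 2 : ℝ) : ℂ) * halfPow β * e2
      - C κ * halfPow β * e3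
      + (C (((θ + 1) / 2 : ℝ) : ℂ) * oneSubPow (-σ) - oneSubPow (-(σ + 1))) * hH
      + (C (β / 2 : ℂ) - (1 - X) * q) * e4
      + (-q - C (((θ + 1) / 2 : ℝ) : ℂ) * C (β / 2 : ℂ)
        + C (((θ + 1) / 2 : ℝ) : ℂ) * (1 - X) * q) * e5
      + C (((θ + 1) / 2 : ℝ) : ℂ) * q * e6
  rw [key]
  have hc := fun c : ℂ => absSum_C c
  exact (((((((hc _).mul_conv c1).add ⟨0, hρ'.tendsto_coeff⟩).sub (hq.mul_conv c1)).sub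
    (((hc _).mul (hc _)).mul_conv c1)).add (((hc _).mul hq).mul_conv c2)).sub
    (((hc _).mul hH1).mul_conv c1)).sub ((hH1.mul hρ).mul_conv c3)

theorem exists_tendsto_quadrature_error {β θ : ℝ} (hβ0 : 0 < β) (hβ1 : β < 1) (hθ : 0 ≤ θ)
    (hθ2 : θ + β ≤ 2) : ∃ L : ℂ, Tendsto (fun n : ℕ =>
      ((Real.Gamma (θ + 1) / Real.Gamma (θ + 1 + β) * (n : ℝ) ^ (θ + β) : ℝ) : ℂ)
        - ∑ k ∈ Finset.range (n + 1), omega β (n - k) * (((k : ℝ) ^ θ : ℝ) : ℂ)) atTop (𝓝 L) := by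
  obtain ⟨L, hL⟩ := conv_quadrature_error hβ0 hβ1 hθ hθ2
  refine ⟨Real.Gamma (θ + 1) * L, (hL.const_mul _).congr fun n => ?_⟩
  have hΓ : Real.Gamma (θ + 1) ≠ 0 := (Real.Gamma_pos_of_pos (by linarith)).ne'
  rw [map_sub, mul_sub, coeff_mul, Nat.sum_antidiagonal_eq_sum_range_succ_mk, mul_sum]
  congr 1
  · rw [powSeries, coeff_mk, ← Complex.ofReal_mul, show θ + 1 + β = θ + β + 1 by ring]
    congr 1
    ring
  · refine sum_congr rfl fun k _ => ?_
    rw [omega_eq_coeff hβ0 hβ1, omegaSeries, powSeries, coeff_mk, ← mul_assoc, ← Complex.ofReal_mul,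
      mul_div_cancel₀ _ hΓ, mul_comm]

/-- The second difference of `n^s` is governed by `(1 - z)^2 (1 - z)^{-s-1}`, and `1 - s > -1`. -/
theorem exists_tendsto_second_difference {s : ℝ} (hs : 0 ≤ s) (hs2 : s < 2) :
    ∃ L : ℂ, Tendsto (fun n : ℕ =>
      (((n : ℝ) ^ s - 2 * ((n : ℝ) - 1) ^ s + ((n : ℝ) - 2) ^ s : ℝ) : ℂ)) atTop (𝓝 L) := by
  obtain ⟨ρ, hρ, hp⟩ := powSeries_eq hs hs2.le
  have hX : AbsSum ((1 - X) ^ 2) := (absSum_one.sub absSum_X).pow 2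
  have e : ∀ α : ℝ, (1 - X) ^ 2 * oneSubPow α = oneSubPow (2 + α) := by
    intro α
    rw [oneSubPow_add]
    congr 1
    exact_mod_cast (oneSubPow_natCast 2).symm
  have hc : Conv ((1 - X) ^ 2 * powSeries s) := by
    rw [hp, mul_add, mul_add, mul_sub, mul_left_comm, mul_left_comm _ (C _), e, e, e]
    exact (((conv_oneSubPow (by linarith)).sub ((absSum_C _).mul_conv
      (conv_oneSubPow (by linarith)))).add ((absSum_C _).mul_conv
      (conv_oneSubPow (by linarith)))).add ⟨0, (hX.mul hρ).tendsto_coeff⟩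
  obtain ⟨L, hL⟩ := hc
  have hΓ : Real.Gamma (s + 1) ≠ 0 := (Real.Gamma_pos_of_pos (by linarith)).ne'
  refine ⟨Real.Gamma (s + 1) * L, (hL.const_mul _).congr' ?_⟩
  filter_upwards [eventually_ge_atTop 2] with n hn
  obtain ⟨m, rfl⟩ := Nat.exists_eq_add_of_le' hn
  have h1 : ((1 - X) ^ 2 : ℂ⟦X⟧) * powSeries s
      = powSeries s - C 2 * (powSeries s * X) + powSeries s * X * X := by
    rw [map_ofNat]; ring
  have h2 : (((m + 2 : ℕ) : ℝ) - 1) = ((m + 1 : ℕ) : ℝ) := by push_cast; ring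
  have h3 : (((m + 2 : ℕ) : ℝ) - 2) = (m : ℝ) := by push_cast; ring
  rw [h1, h2, h3, map_add, map_sub, coeff_C_mul, coeff_succ_mul_X, coeff_succ_mul_X,
    coeff_succ_mul_X, powSeries, coeff_mk, coeff_mk, coeff_mk]
  norm_cast
  field_simp

theorem exists_tendsto_solveWeights {θ : ℕ → ℝ} {m : ℕ} {b : ℕ → ℝ → ℂ}
    (hb : ∀ r ∈ Set.Icc 1 m, ∃ L : ℂ, Tendsto (fun n => b n (θ r)) atTop (𝓝 L)) (k : Fin m) :
    ∃ L : ℂ, Tendsto (fun n => solveWeights θ m (b n) k) atTop (𝓝 L) := by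
  have h : ∀ r : Fin m, ∃ L : ℂ, Tendsto (fun n => b n (θ ((r : ℕ) + 1))) atTop (𝓝 L) :=
    fun r => hb _ ⟨by omega, by omega⟩
  choose L hL using h
  exact ⟨∑ r, (powMatrix θ m)⁻¹ k r * L r, tendsto_finsetSum _ fun r _ => (hL r).const_mul _⟩

theorem exists_tendsto_startWeight {β : ℝ} (hβ0 : 0 < β) (hβ1 : β < 1) {θ : ℕ → ℝ} {m : ℕ}
    (h0 : ∀ r ∈ Set.Icc 1 m, 0 < θ r) (h2 : ∀ r ∈ Set.Icc 1 m, θ r ≤ 2 - β) (k : Fin m) :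
    ∃ L : ℂ, Tendsto (fun n => startWeight β θ m n k) atTop (𝓝 L) :=
  exists_tendsto_solveWeights (fun r hr => exists_tendsto_quadrature_error hβ0 hβ1 (h0 r hr).le
    (by linarith [h2 r hr])) k

theorem exists_tendsto_initWeight {β : ℝ} (hβ0 : 0 < β) (hβ1 : β < 1) {θ : ℕ → ℝ} {m : ℕ}
    (h0 : ∀ r ∈ Set.Icc 1 m, 0 < θ r) (h2 : ∀ r ∈ Set.Icc 1 m, θ r ≤ 2 - β) :
    ∃ L : ℂ, Tendsto (fun n => initWeight β θ m n) atTop (𝓝 L) := by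
  choose L hL using exists_tendsto_startWeight hβ0 hβ1 h0 h2
  obtain ⟨L', hL'⟩ := exists_tendsto_quadrature_error hβ0 hβ1 le_rfl (by linarith : 0 + β ≤ 2)
  refine ⟨L' - ∑ k, L k, (hL'.sub (tendsto_finsetSum _ fun k _ => hL k)).congr fun n => ?_⟩
  simp [initWeight, div_eq_inv_mul]

theorem exists_tendsto_extrapWeight {θ : ℕ → ℝ} {m : ℕ}
    (h0 : ∀ r ∈ Set.Icc 1 m, 0 < θ r) (h2 : ∀ r ∈ Set.Icc 1 m, θ r < 2) (k : Fin m) :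
    ∃ L : ℂ, Tendsto (fun n => extrapWeight θ m n k) atTop (𝓝 L) :=
  exists_tendsto_solveWeights (b := fun n s =>
    (((n : ℝ) ^ s - 2 * ((n : ℝ) - 1) ^ s + ((n : ℝ) - 2) ^ s : ℝ) : ℂ))
    (fun r hr => exists_tendsto_second_difference (h0 r hr).le (h2 r hr)) k

/-! ### The scheme as a convolution equation -/

/-- The convolution part of the scheme: `1 - ξ ((k + 1) ω(z) - k ω_0 (1 - z)^2)`. -/
def schemeSeries (β : ℝ) (k ξ : ℂ) : ℂ⟦X⟧ :=
  1 - C ξ * (C (k + 1) * omegaSeries β - C (k * omega β 0) * (1 - X) ^ 2)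

/-- The contribution of the starting values to step `n` of the scheme. -/
def startTerm (β : ℝ) (k ξ : ℂ) (σ δ : ℕ → ℝ) (mu mf mtf : ℕ) (U : ℕ → ℂ) (n : ℕ) : ℂ :=
  U 0 + ξ * (∑ j : Fin mu, startWeight β σ mu n j * U ((j : ℕ) + 1) + initWeight β σ mu n * U 0)
    + k * ξ * (∑ j : Fin mf, startWeight β δ mf n j * U ((j : ℕ) + 1)
      + initWeight β δ mf n * U 0)
    + k * ξ * omega β 0 * ∑ j : Fin mtf, extrapWeight δ mtf n j * (U ((j : ℕ) + 1) - U 0)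

theorem startTerm_congr (β : ℝ) (k ξ : ℂ) (σ δ : ℕ → ℝ) {mu mf mtf : ℕ} {U V : ℕ → ℂ}
    (h : ∀ n < numStart mu mf mtf, U n = V n) (n : ℕ) :
    startTerm β k ξ σ δ mu mf mtf U n = startTerm β k ξ σ δ mu mf mtf V n := by
  have h0 : U 0 = V 0 := h 0 (by unfold numStart; omega)
  have hu : ∀ j : Fin mu, U ((j : ℕ) + 1) = V ((j : ℕ) + 1) := fun j =>
    h _ (by unfold numStart; omega)
  have hf : ∀ j : Fin mf, U ((j : ℕ) + 1) = V ((j : ℕ) + 1) := fun j =>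
    h _ (by unfold numStart; omega)
  have ht : ∀ j : Fin mtf, U ((j : ℕ) + 1) = V ((j : ℕ) + 1) := fun j =>
    h _ (by unfold numStart; omega)
  simp only [startTerm, h0, hu, hf, ht]

theorem exists_tendsto_startTerm {β : ℝ} (hβ0 : 0 < β) (hβ1 : β < 1) (k ξ : ℂ)
    {σ δ : ℕ → ℝ} {mu mf mtf : ℕ}
    (hσ0 : ∀ r ∈ Set.Icc 1 mu, 0 < σ r) (hσ2 : ∀ r ∈ Set.Icc 1 mu, σ r ≤ 2 - β)
    (hδ0 : ∀ r ∈ Set.Icc 1 (max mf mtf), 0 < δ r)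
    (hδ2 : ∀ r ∈ Set.Icc 1 (max mf mtf), δ r ≤ 2 - β) (U : ℕ → ℂ) :
    ∃ L : ℂ, Tendsto (startTerm β k ξ σ δ mu mf mtf U) atTop (𝓝 L) := by
  have hf : Set.Icc 1 mf ⊆ Set.Icc 1 (max mf mtf) := Set.Icc_subset_Icc_right (le_max_left _ _)
  have ht : Set.Icc 1 mtf ⊆ Set.Icc 1 (max mf mtf) := Set.Icc_subset_Icc_right (le_max_right _ _)
  choose L1 h1 using exists_tendsto_startWeight hβ0 hβ1 hσ0 hσ2
  obtain ⟨L2, h2⟩ := exists_tendsto_initWeight hβ0 hβ1 hσ0 hσ2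
  choose L3 h3 using exists_tendsto_startWeight hβ0 hβ1 (fun r hr => hδ0 r (hf hr))
    (fun r hr => hδ2 r (hf hr))
  obtain ⟨L4, h4⟩ := exists_tendsto_initWeight hβ0 hβ1 (fun r hr => hδ0 r (hf hr))
    (fun r hr => hδ2 r (hf hr))
  choose L5 h5 using exists_tendsto_extrapWeight (θ := δ) (m := mtf) (fun r hr => hδ0 r (ht hr))
    (fun r hr => by linarith [hδ2 r (ht hr)])
  exact ⟨_, (((tendsto_const_nhds (x := U 0)).add
    (((tendsto_finsetSum _ fun j _ => (h1 j).mul_const _).add (h2.mul_const _)).const_mul ξ)).add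
    (((tendsto_finsetSum _ fun j _ => (h3 j).mul_const _).add (h4.mul_const _)).const_mul
      (k * ξ))).add
    ((tendsto_finsetSum _ fun j _ => (h5 j).mul_const _).const_mul (k * ξ * omega β 0))⟩

theorem coeff_omegaSeries_mul {β : ℝ} (hβ0 : 0 < β) (hβ1 : β < 1) (U : ℕ → ℂ) (n : ℕ) :
    coeff n (omegaSeries β * PowerSeries.mk U) = ∑ k ∈ range (n + 1), omega β (n - k) * U k := by
  rw [mul_comm, coeff_mul, Nat.sum_antidiagonal_eq_sum_range_succ_mk]
  refine sum_congr rfl fun k _ => ?_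
  rw [omega_eq_coeff hβ0 hβ1, omegaSeries, coeff_mk, mul_comm]

theorem coeff_one_sub_X_sq_mul (U : ℕ → ℂ) {n : ℕ} (hn : 2 ≤ n) :
    coeff n ((1 - X) ^ 2 * PowerSeries.mk U) = U n - 2 * U (n - 1) + U (n - 2) := by
  obtain ⟨m, rfl⟩ := Nat.exists_eq_add_of_le' hn
  have h1 : ((1 - X) ^ 2 : ℂ⟦X⟧) * PowerSeries.mk U
      = PowerSeries.mk U - C 2 * (PowerSeries.mk U * X) + PowerSeries.mk U * X * X := by
    rw [map_ofNat]; ring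
  rw [h1, map_add, map_sub, coeff_C_mul, coeff_succ_mul_X, coeff_succ_mul_X,
    coeff_succ_mul_X, coeff_mk, coeff_mk, coeff_mk]
  rfl

/-- The scheme is the convolution equation `(1 - ξ w) U = startTerm + g` in the steps `n ≥ n₀`. -/
theorem isSolution_iff {β : ℝ} (hβ0 : 0 < β) (hβ1 : β < 1) (k lam : ℂ) (h : ℝ)
    (σ δ : ℕ → ℝ) (mu mf mtf : ℕ) (g U : ℕ → ℂ) :
    IsSolution β lam (fun _ u => k * lam * u) h σ δ mu mf mtf g U ↔
      ∀ n, numStart mu mf mtf ≤ n →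
        coeff n (schemeSeries β k (lam * ((h ^ β : ℝ) : ℂ)) * PowerSeries.mk U)
          = startTerm β k (lam * ((h ^ β : ℝ) : ℂ)) σ δ mu mf mtf U n + g n := by
  refine forall_congr' fun n => imp_congr_right fun hn => ?_
  have hn2 : 2 ≤ n := le_trans (by unfold numStart; omega) hn
  have h1 : schemeSeries β k (lam * ((h ^ β : ℝ) : ℂ)) * PowerSeries.mk U
      = PowerSeries.mk U - C (lam * ((h ^ β : ℝ) : ℂ)) *
        (C (k + 1) * (omegaSeries β * PowerSeries.mk U)
          - C (k * omega β 0) * ((1 - X) ^ 2 * PowerSeries.mk U)) := by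
    rw [schemeSeries]; ring
  rw [h1, map_sub, coeff_C_mul, map_sub, coeff_C_mul, coeff_C_mul, coeff_omegaSeries_mul hβ0 hβ1,
    coeff_one_sub_X_sq_mul U hn2, coeff_mk]
  simp only [quad, startTerm, mul_left_comm _ (k * lam) (U _), mul_left_comm _ (k * lam),
    ← mul_sub, ← mul_sum]
  constructor <;> intro H <;> linear_combination H

theorem coeff_mul_congr {f g g' : ℂ⟦X⟧} {n : ℕ} (h : ∀ j ≤ n, coeff j g = coeff j g') :
    coeff n (f * g) = coeff n (f * g') := by
  rw [coeff_mul, coeff_mul]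
  refine sum_congr rfl fun p hp => ?_
  rw [h p.2 (by have := HasAntidiagonal.mem_antidiagonal.1 hp; omega)]

/-- The product of `1 - ξ w` with `(1 - z)^β`, which removes the singularity at `z = 1`. -/
def symbolSeries (β : ℝ) (k ξ : ℂ) : ℂ⟦X⟧ :=
  oneSubPow β - C ξ * (C (k + 1) * halfPow β
    - C (k * omega β 0) * ((1 - X) ^ 2 * oneSubPow β))

theorem oneSubPow_mul_schemeSeries (β : ℝ) (k ξ : ℂ) :
    oneSubPow β * schemeSeries β k ξ = symbolSeries β k ξ := by
  have h := oneSubPow_neg_mul_self β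
  rw [schemeSeries, symbolSeries, omegaSeries]
  linear_combination (-C ξ * C (k + 1) * halfPow β) * h

theorem absSum_symbolSeries {β : ℝ} (hβ0 : 0 < β) (hβ1 : β < 1) (k ξ : ℂ) :
    AbsSum (symbolSeries β k ξ) := by
  have h := absSum_oneSubPow hβ0 hβ1
  exact h.sub ((absSum_C _).mul (((absSum_C _).mul (absSum_halfPow hβ0 hβ1)).sub
    ((absSum_C _).mul (((absSum_one.sub absSum_X).pow 2).mul h))))

theorem ev_symbolSeries {β : ℝ} (hβ0 : 0 < β) (hβ1 : β < 1) (k ξ : ℂ) {z : ℂ} (hz : ‖z‖ ≤ 1) :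
    ev (symbolSeries β k ξ) z = (1 - z) ^ (β : ℂ) - ξ * ((k + 1) * ((1 / 2) * (1 + z)) ^ (β : ℂ)
      - k * omega β 0 * ((1 - z) ^ 2 * (1 - z) ^ (β : ℂ))) := by
  have h := absSum_oneSubPow hβ0 hβ1
  have hh := absSum_halfPow hβ0 hβ1
  have hX := absSum_one.sub absSum_X
  have h1 := (absSum_C (k + 1)).mul hh
  have h2 := (hX.pow 2).mul h
  have h3 := (absSum_C (k * omega β 0)).mul h2
  rw [symbolSeries, h.ev_sub ((absSum_C _).mul (h1.sub h3)) hz,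
    (absSum_C _).ev_mul (h1.sub h3) hz, h1.ev_sub h3 hz, (absSum_C _).ev_mul hh hz,
    (absSum_C _).ev_mul h2 hz, (hX.pow 2).ev_mul h hz, hX.ev_pow hz,
    absSum_one.ev_sub absSum_X hz, ev_oneSubPow hβ0 hβ1 hz, ev_halfPow hβ0 hβ1 hz, ev_C, ev_C,
    ev_C, ev_one, ev_X]

theorem one_sub_cpow_ne_zero {β : ℝ} {z : ℂ} (hz1 : z ≠ 1) : (1 - z) ^ (β : ℂ) ≠ 0 := by
  rw [Complex.cpow_ne_zero_iff]
  exact Or.inl (sub_ne_zero.2 hz1.symm)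

theorem ev_symbolSeries_of_ne {β : ℝ} (hβ0 : 0 < β) (hβ1 : β < 1) (k ξ : ℂ) {z : ℂ}
    (hz : ‖z‖ ≤ 1) (hz1 : z ≠ 1) :
    ev (symbolSeries β k ξ) z = (1 - z) ^ (β : ℂ)
      * (1 - ξ * ((k + 1) * genFun β z - k * omega β 0 * (1 - z) ^ 2)) := by
  have h := one_sub_cpow_ne_zero (β := β) hz1
  rw [ev_symbolSeries hβ0 hβ1 k ξ hz, genFun_eq hβ0.ne' hz hz1]
  field_simp

theorem ev_symbolSeries_one {β : ℝ} (hβ0 : 0 < β) (hβ1 : β < 1) (k ξ : ℂ) :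
    ev (symbolSeries β k ξ) 1 = -ξ * (k + 1) := by
  have h : (β : ℂ) ≠ 0 := by exact_mod_cast hβ0.ne'
  rw [ev_symbolSeries hβ0 hβ1 k ξ (by simp), sub_self, Complex.zero_cpow h]
  norm_num

/-! ### Sufficiency -/

/-- If `D = (1 - z)^β (1 - ξ w)` has no zero in the closed disc, the resolvent
`r = 1 / (1 - ξ w) = (1 - z)^β / D` is in `ℓ¹` by Wiener's lemma, and `r(1) = 0`. The solution is
`r G` with a convergent sequence `G`, hence tends to `G(∞) r(1) = 0`. -/
theorem isStable_of_symbolSeries_ne_zero {β : ℝ} (hβ0 : 0 < β) (hβ1 : β < 1) (k lam : ℂ) (h : ℝ)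
    {σ δ : ℕ → ℝ} {mu mf mtf : ℕ}
    (hσ0 : ∀ r ∈ Set.Icc 1 mu, 0 < σ r) (hσ2 : ∀ r ∈ Set.Icc 1 mu, σ r ≤ 2 - β)
    (hδ0 : ∀ r ∈ Set.Icc 1 (max mf mtf), 0 < δ r)
    (hδ2 : ∀ r ∈ Set.Icc 1 (max mf mtf), δ r ≤ 2 - β)
    (hD : ∀ z : ℂ, ‖z‖ ≤ 1 → ev (symbolSeries β k (lam * ((h ^ β : ℝ) : ℂ))) z ≠ 0) :
    IsStable β lam (k * lam) h σ δ mu mf mtf := by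
  set ξ := lam * ((h ^ β : ℝ) : ℂ) with hξ
  set N := numStart mu mf mtf with hN
  intro a g hg
  obtain ⟨e, he, hDe⟩ := (absSum_symbolSeries hβ0 hβ1 k ξ).exists_mul_eq_one hD
  have hy := absSum_oneSubPow hβ0 hβ1
  have hβ' : (β : ℂ) ≠ 0 := by exact_mod_cast hβ0.ne'
  set r := oneSubPow β * e with hr
  have hrs : r * schemeSeries β k ξ = 1 := by
    rw [← hDe, ← oneSubPow_mul_schemeSeries, hr]; ring
  have hr1 : ev r 1 = 0 := by
    rw [hr, hy.ev_mul he (by simp), ev_oneSubPow hβ0 hβ1 (by simp), sub_self,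
      Complex.zero_cpow hβ', zero_mul]
  -- Below `n₀` the forcing is chosen so as to reproduce the prescribed starting values.
  set G : ℂ⟦X⟧ := PowerSeries.mk fun n =>
    if n < N then coeff n (schemeSeries β k ξ * PowerSeries.mk a)
    else startTerm β k ξ σ δ mu mf mtf a n + g n with hG
  have hGc : Tendsto (fun n => coeff n (r * G)) atTop (𝓝 0) := by
    obtain ⟨L, hL⟩ := hg
    obtain ⟨L', hL'⟩ := exists_tendsto_startTerm hβ0 hβ1 k ξ hσ0 hσ2 hδ0 hδ2 a
    have h1 : Tendsto (fun n => coeff n G) atTop (𝓝 (L' + L)) := by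
      refine (hL'.add hL).congr' ?_
      filter_upwards [eventually_ge_atTop N] with n hn
      simp only [hG, coeff_mk]
      rw [if_neg (by omega)]
    have h2 := ((hy.mul he).tendsto_coeff_mul h1)
    rwa [← hr, hr1, zero_mul] at h2
  have hiff : ∀ U : ℕ → ℂ, ((∀ n < N, U n = a n) ∧
      IsSolution β lam (fun _ u => k * lam * u) h σ δ mu mf mtf g U) ↔
        PowerSeries.mk U = r * G := by
    intro U
    rw [isSolution_iff hβ0 hβ1]
    constructor
    · rintro ⟨hU, hs⟩
      have h1 : schemeSeries β k ξ * PowerSeries.mk U = G := by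
        ext n
        simp only [hG, coeff_mk]
        split_ifs with hn
        · exact coeff_mul_congr fun j hj => by
            rw [coeff_mk, coeff_mk, hU j (by omega)]
        · rw [hs n (by omega), startTerm_congr β k ξ σ δ hU]
      rw [← h1, ← mul_assoc, hrs, one_mul]
    · intro hU
      have h1 : schemeSeries β k ξ * PowerSeries.mk U = G := by
        rw [hU, ← mul_assoc, mul_comm _ r, hrs, one_mul]
      have h2 : ∀ n < N, U n = a n := by
        intro n hn
        have h3 : coeff n (r * G) = coeff n (r * (schemeSeries β k ξ * PowerSeries.mk a)) :=
          coeff_mul_congr fun j hj => by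
            simp only [hG, coeff_mk]
            rw [if_pos (by omega)]
        rw [← hU, ← mul_assoc, hrs, one_mul, coeff_mk, coeff_mk] at h3
        exact h3
      refine ⟨h2, fun n hn => ?_⟩
      rw [h1, startTerm_congr β k ξ σ δ h2]
      simp only [hG, coeff_mk]
      rw [if_neg (by omega)]
  refine ⟨⟨fun n => coeff n (r * G), (hiff _).2 (by ext n; simp), fun V hV => ?_⟩,
    fun U hU hs => ?_⟩
  · funext n
    rw [← (hiff V).1 hV, coeff_mk]
  · have h1 := (hiff U).1 ⟨hU, hs⟩
    rw [← h1] at hGc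
    simpa using hGc

/-! ### Necessity -/

/-- In a stable method, a sequence with convergent defect tends to zero. -/
theorem IsStable.tendsto_zero {β : ℝ} (hβ0 : 0 < β) (hβ1 : β < 1) {k lam : ℂ} {h : ℝ}
    {σ δ : ℕ → ℝ} {mu mf mtf : ℕ}
    (hσ0 : ∀ r ∈ Set.Icc 1 mu, 0 < σ r) (hσ2 : ∀ r ∈ Set.Icc 1 mu, σ r ≤ 2 - β)
    (hδ0 : ∀ r ∈ Set.Icc 1 (max mf mtf), 0 < δ r)
    (hδ2 : ∀ r ∈ Set.Icc 1 (max mf mtf), δ r ≤ 2 - β)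
    (hst : IsStable β lam (k * lam) h σ δ mu mf mtf) {u : ℂ⟦X⟧}
    (hu : Conv (schemeSeries β k (lam * ((h ^ β : ℝ) : ℂ)) * u)) :
    Tendsto (fun n => coeff n u) atTop (𝓝 0) := by
  set ξ := lam * ((h ^ β : ℝ) : ℂ) with hξ
  set U : ℕ → ℂ := fun n => coeff n u with hU
  have huU : u = PowerSeries.mk U := by ext n; simp [hU]
  obtain ⟨L, hL⟩ := hu
  obtain ⟨L', hL'⟩ := exists_tendsto_startTerm hβ0 hβ1 k ξ hσ0 hσ2 hδ0 hδ2 U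
  refine (hst U (fun n => coeff n (schemeSeries β k ξ * u) - startTerm β k ξ σ δ mu mf mtf U n)
    ⟨L - L', hL.sub hL'⟩).2 U (fun _ _ => rfl) ?_
  rw [isSolution_iff hβ0 hβ1]
  intro n _
  rw [← huU, ← hξ]
  ring

/-- The geometric series `1 / (1 - z / z₀)`. -/
def geomSeries (z₀ : ℂ) : ℂ⟦X⟧ := PowerSeries.mk fun n => z₀⁻¹ ^ n

theorem pow_mul_coeff_mul_geomSeries (f : ℂ⟦X⟧) {z₀ : ℂ} (h0 : z₀ ≠ 0) (n : ℕ) :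
    z₀ ^ n * coeff n (f * geomSeries z₀) = ∑ j ∈ range (n + 1), coeff j f * z₀ ^ j := by
  rw [coeff_mul, Nat.sum_antidiagonal_eq_sum_range_succ_mk, mul_sum]
  refine sum_congr rfl fun j hj => ?_
  have hjn : j + (n - j) = n := by have := mem_range.1 hj; omega
  rw [geomSeries, coeff_mk, inv_pow]
  conv_lhs => rw [← hjn, pow_add]
  simp only [add_tsub_cancel_left]
  field_simp

/-- If `f(z₀) = 0`, the coefficients of `f / (1 - z / z₀)` are tails of `∑ f_j z₀^j`, up to sign
and normalization. -/
theorem AbsSum.tendsto_coeff_mul_geomSeries {f : ℂ⟦X⟧} (hf : AbsSum f) {z₀ : ℂ} (h0 : z₀ ≠ 0)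
    (h1 : ‖z₀‖ ≤ 1) (hz : ev f z₀ = 0) :
    Tendsto (fun n => coeff n (f * geomSeries z₀)) atTop (𝓝 0) := by
  have hfs : Summable fun n => ‖coeff n f‖ := hf
  have ht := (tendsto_add_atTop_iff_nat 1).2 (tendsto_sum_nat_add fun n => ‖coeff n f‖)
  refine squeeze_zero_norm (fun n => ?_) ht
  have hs := (hf.hasSum_ev h1).summable.sum_add_tsum_nat_add (n + 1)
  rw [← pow_mul_coeff_mul_geomSeries f h0, show ∑' n, coeff n f * z₀ ^ n = 0 from hz] at hs
  have hz0 : (0 : ℝ) < ‖z₀‖ ^ n := by have := norm_pos_iff.2 h0; positivity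
  have hn : ‖z₀‖ ^ n * ‖coeff n (f * geomSeries z₀)‖
      ≤ ‖z₀‖ ^ n * ∑' i, ‖coeff (i + (n + 1)) f‖ := by
    rw [← norm_pow, ← norm_mul, eq_neg_of_add_eq_zero_left hs, norm_neg, ← tsum_mul_left]
    have hs1 := (summable_nat_add_iff (n + 1)).2 hfs
    refine tsum_of_norm_bounded (hs1.mul_left (‖z₀ ^ n‖)).hasSum fun i => ?_
    rw [norm_mul, norm_pow, norm_pow, mul_comm]
    refine mul_le_mul_of_nonneg_right ?_ (norm_nonneg _)
    exact pow_le_pow_of_le_one (norm_nonneg _) h1 (by omega)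
  exact le_of_mul_le_mul_left hn hz0

/-- Converse: otherwise the coefficients of `f / (1 - z / z₀)` have modulus at least of the order of
`|f(z₀)|`. -/
theorem AbsSum.ev_eq_zero_of_tendsto {f : ℂ⟦X⟧} (hf : AbsSum f) {z₀ : ℂ} (h0 : z₀ ≠ 0)
    (h1 : ‖z₀‖ ≤ 1) (hz : Tendsto (fun n => coeff n (f * geomSeries z₀)) atTop (𝓝 0)) :
    ev f z₀ = 0 := by
  have h2 : Tendsto (fun n => z₀ ^ n * coeff n (f * geomSeries z₀)) atTop (𝓝 0) := by
    refine squeeze_zero_norm (fun n => ?_) (by simpa using hz.norm)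
    rw [norm_mul, norm_pow]
    exact mul_le_of_le_one_left (norm_nonneg _) (pow_le_one₀ (norm_nonneg _) h1)
  simp only [pow_mul_coeff_mul_geomSeries f h0] at h2
  exact tendsto_nhds_unique
    ((tendsto_add_atTop_iff_nat 1).2 (hf.hasSum_ev h1).tendsto_sum_nat) h2

/-- Step `n₀` of the scheme is not solvable when the leading coefficient vanishes. -/
theorem not_isStable_of_mul_omega_zero_eq_one {β : ℝ} (hβ0 : 0 < β) (hβ1 : β < 1) {k lam : ℂ}
    {h : ℝ} {σ δ : ℕ → ℝ} {mu mf mtf : ℕ} (hξ : lam * ((h ^ β : ℝ) : ℂ) * omega β 0 = 1) :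
    ¬ IsStable β lam (k * lam) h σ δ mu mf mtf := by
  intro hst
  -- Zero starting values and `g = 1`: the equation at `n₀` reads `0 = 1`.
  obtain ⟨U, ⟨hU, hs⟩, -⟩ := (hst 0 1 ⟨1, tendsto_const_nhds⟩).1
  rw [isSolution_iff hβ0 hβ1] at hs
  have h1 := hs _ le_rfl
  rw [startTerm_congr β k _ σ δ hU, coeff_mul, sum_eq_zero] at h1
  · simp [startTerm] at h1
  · intro p hp
    rcases eq_or_ne p.1 0 with h0 | h0
    · have h2 : coeff 0 (omegaSeries β) = omega β 0 := (omega_eq_coeff hβ0 hβ1 0).symm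
      have h3 : coeff 0 (schemeSeries β k (lam * ((h ^ β : ℝ) : ℂ))) = 0 := by
        rw [schemeSeries, map_sub, coeff_C_mul, map_sub, coeff_C_mul, coeff_C_mul, h2]
        simp
        linear_combination -hξ
      rw [h0, h3, zero_mul]
    · have := HasAntidiagonal.mem_antidiagonal.1 hp
      rw [coeff_mk, hU _ (by omega), Pi.zero_apply, mul_zero]

end IMEXE

end

/-- Linear stability of IMEX-E. In the excluded set, `ω^{(β)}(1) = ∞`, so that `z = 1` contributes
the value `ξ = 0`; a `z` with vanishing denominator contributes no (finite) value. -/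
theorem theorem3p3 (β : ℝ) (hβ0 : 0 < β) (hβ1 : β < 1) (k : ℂ) (hk : k ≠ -1)
    (σ δ : ℕ → ℝ) (mu mf mtf : ℕ)
    (hσ0 : ∀ r ∈ Set.Icc 1 mu, 0 < σ r) (hσ : StrictMonoOn σ (Set.Icc 1 mu))
    (hσ2 : ∀ r ∈ Set.Icc 1 mu, σ r ≤ 2 - β)
    (hδ0 : ∀ r ∈ Set.Icc 1 (max mf mtf), 0 < δ r)
    (hδ : StrictMonoOn δ (Set.Icc 1 (max mf mtf)))
    (hδ2 : ∀ r ∈ Set.Icc 1 (max mf mtf), δ r ≤ 2 - β) :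
    IMEXE.stabilityRegion β k σ δ mu mf mtf =
      Set.univ \ ({ξ : ℂ | ∃ z : ℂ, ‖z‖ ≤ 1 ∧ z ≠ 1 ∧
        (k + 1) * IMEXE.genFun β z - k * IMEXE.omega β 0 * (1 - z) ^ 2 ≠ 0 ∧
        ξ = 1 / ((k + 1) * IMEXE.genFun β z - k * IMEXE.omega β 0 * (1 - z) ^ 2)} ∪ {0}) := by
  open IMEXE in
  ext ξ
  simp only [stabilityRegion, Set.mem_ofPred_eq, Set.mem_sdiff, Set.mem_univ, true_and,
    Set.mem_union, Set.mem_singleton_iff, not_or]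
  constructor
  · intro hst
    have hξ1 : ξ * (((1 : ℝ) ^ β : ℝ) : ℂ) = ξ := by simp
    have hst1 := hst ξ 1 one_pos hξ1.symm
    have hz := fun u => IsStable.tendsto_zero hβ0 hβ1 hσ0 hσ2 hδ0 hδ2 hst1 (u := u)
    rw [hξ1] at hz
    refine ⟨?_, ?_⟩
    · rintro ⟨z, hz1, hzne, hw, hξ⟩
      have hD : ev (symbolSeries β k ξ) z = 0 := by
        rw [ev_symbolSeries_of_ne hβ0 hβ1 k ξ hz1 hzne, hξ, one_div_mul_cancel hw, sub_self,
          mul_zero]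
      rcases eq_or_ne z 0 with rfl | hz0
      · refine not_isStable_of_mul_omega_zero_eq_one hβ0 hβ1 ?_ hst1
        have h0 : omega β 0 = genFun β 0 := by simp [omega]
        rw [hξ1, hξ, ← h0]
        have hw' : (k + 1) * omega β 0 - k * omega β 0 * (1 - 0) ^ 2 = omega β 0 := by ring
        rw [hw', one_div_mul_cancel (omega_zero_ne_zero β)]
      -- `U = (1 - X)^β / (1 - X / z)` does not tend to `0`, but its defect `D / (1 - X / z)` does.
      · have hy := absSum_oneSubPow hβ0 hβ1
        have h1 := hz (oneSubPow β * geomSeries z) ⟨0, by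
          rw [← mul_assoc, mul_comm _ (oneSubPow β), oneSubPow_mul_schemeSeries]
          exact (absSum_symbolSeries hβ0 hβ1 k ξ).tendsto_coeff_mul_geomSeries hz0 hz1 hD⟩
        have h2 := hy.ev_eq_zero_of_tendsto hz0 hz1 h1
        rw [ev_oneSubPow hβ0 hβ1 hz1] at h2
        exact one_sub_cpow_ne_zero hzne h2
    -- For `ξ = 0` the constant sequence `1` has a convergent defect.
    · rintro rfl
      have h1 := hz (oneSubPow (-1)) (by
        simpa [schemeSeries] using conv_oneSubPow le_rfl)
      simp only [coeff_oneSubPow, powCoeff_neg_one] at h1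
      have h2 := tendsto_nhds_unique h1 tendsto_const_nhds
      simp at h2
  · rintro ⟨hw, hξ0⟩ lam h hh rfl
    refine isStable_of_symbolSeries_ne_zero hβ0 hβ1 k lam h hσ0 hσ2 hδ0 hδ2 fun z hz hD => ?_
    rcases eq_or_ne z 1 with rfl | hz1
    · rw [ev_symbolSeries_one hβ0 hβ1] at hD
      refine mul_ne_zero (neg_ne_zero.2 hξ0) (fun h => hk ?_) hD
      linear_combination h
    · rw [ev_symbolSeries_of_ne hβ0 hβ1 k _ hz hz1] at hD
      have h1 := (mul_eq_zero.1 hD).resolve_left (one_sub_cpow_ne_zero hz1)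
      rw [sub_eq_zero] at h1
      have hne := right_ne_zero_of_mul_eq_one h1.symm
      exact hw ⟨z, hz, hz1, hne, eq_one_div_of_mul_eq_one_left h1.symm⟩
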